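/- Let $H\in(0,1)$ and $T\ge 0$. Let $\mu(d\lambda)=(2\pi)^{-1}\sin(\pi H)\Gamma(1+2H)|\lambda|^{1-2H}\,d\lambda$ on $\mathbb R$, let $e_t(\lambda)=(e^{i\lambda t}-1)/(i\lambda)$ (with $e_t(0)=t$), and let the spectral space $\mathcal L_T$ be the closure in $L^2(\mu)$ of the complex linear span of $\{e_t: t\in[0,T]\}$. Let $V_u=d_H^2u^{2-2H}$ with $d_H^2=\frac{\Gamma(3/2-H)}{2H\,\Gamma(H+1/2)\,\Gamma(3-2H)}$, let $$x_t(u)=2H\Big(t^{H-1/2}(t-u)^{H-1/2}-\int_u^t (v-u)^{H-1/2}\,d\big(v^{H-1/2}\big)\Big)\mathbb 1_{(0,t)}(u),$$ and let $\mathcal K_T$ be the closure in $L^2([0,T],dV)$ of the complex linear span of $\{x_t:t\in[0,T]\}$. Let $\varphi(0)=1$ and, for $z\in\mathbb C\setminus\{0\}$, $$\varphi(z)=\Gamma(1-H)\Big(\frac z4\Big)^{H}e^{iz/2}\Big(J_{-H}\big(\tfrac z2\big)+i\,J_{1-H}\big(\tfrac z2\big)\Big),$$ where $J_\nu$ is the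 Bessel function of the first kind of order $\nu$ and all powers are principal. Then there is a linear isometry $U$ of $\mathcal K_T$ onto $\mathcal L_T$ with $Ux_t=e_t$ for all $t\in[0,T]$. Moreover, every element $\psi$ of $\mathcal L_T$ has a version that is the restriction to $\mathbb R$ of an entire function: with $f=U^{-1}\psi\in\mathcal K_T$, the integral $$\int_0^T f(u)\,\varphi(uz)\,dV_u$$ converges absolutely for every $z\in\mathbb C$, it is an entire function of $z$, and $\psi(\lambda)=\int_0^T f(u)\varphi(u\lambda)\,dV_u$ for $\mu$-almost every $\lambda\in\mathbb R$. -/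

import Mathlib

open MeasureTheory Set

noncomputable section

namespace FBM

/-- The spectral measure of the fractional Brownian motion with Hurst index `H`:
`μ(dl) = (2π)⁻¹ sin(πH) Γ(1+2H) |l|^(1-2H) dl` on `ℝ`. -/
def specMeasure (H : ℝ) : Measure ℝ :=
  volume.withDensity fun l =>
    ENNReal.ofReal ((2 * Real.pi)⁻¹ * Real.sin (Real.pi * H) * Real.Gamma (1 + 2 * H)
      * |l| ^ (1 - 2 * H))

/-- `e_t(l) = (exp(ilt) - 1)/(il)`, with the continuous value `t` at `l = 0`; this is the Fourier
transform `∫_ℝ 1_{(0,t)}(x) exp(ilx) dx`. -/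
def expFun (t l : ℝ) : ℂ :=
  if l = 0 then (t : ℂ)
  else (Complex.exp (Complex.I * l * t) - 1) / (Complex.I * l)

/-- The spectral space `𝓛_T`: the closure in `L²(μ)` of the complex linear span of the (classes of
the) functions `e_t`, `t ∈ [0,T]`. -/
def specSpace (H T : ℝ) : Submodule ℂ (Lp ℂ 2 (specMeasure H)) :=
  (Submodule.span ℂ
    {g : Lp ℂ 2 (specMeasure H) | ∃ t ∈ Icc 0 T, g =ᵐ[specMeasure H] expFun t}).topologicalClosure

/-- The constant `d_H² = Γ(3/2-H) / (2H Γ(H+1/2) Γ(3-2H))`. -/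
def dSq (H : ℝ) : ℝ :=
  Real.Gamma (3 / 2 - H) / (2 * H * Real.Gamma (H + 1 / 2) * Real.Gamma (3 - 2 * H))

/-- The measure `dV` on `[0,T]`, for the variance function `V_u = d_H² u^(2-2H)` of the fundamental
martingale: `dV_u = d_H² (2-2H) u^(1-2H) du`. -/
def varMeasure (H T : ℝ) : Measure ℝ :=
  (volume.restrict (Icc 0 T)).withDensity fun u =>
    ENNReal.ofReal (dSq H * (2 - 2 * H) * u ^ (1 - 2 * H))

/-- The kernel of the moving average representation `X_t = ∫_0^t x_t(u) dM_u` of the fractional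
Brownian motion with respect to the fundamental martingale:
`x_t(u) = 2H (t^(H-1/2) (t-u)^(H-1/2) - ∫_u^t (v-u)^(H-1/2) d(v^(H-1/2))) 1_{(0,t)}(u)`. -/
def movAvgKernel (H t u : ℝ) : ℂ :=
  (Ioo 0 t).indicator
    (fun u : ℝ => ((2 * H * (t ^ (H - 1 / 2) * (t - u) ^ (H - 1 / 2)
      - ∫ v in u..t, (v - u) ^ (H - 1 / 2) * ((H - 1 / 2) * v ^ (H - 3 / 2))) : ℝ) : ℂ)) u

/-- The space of integration kernels `𝓚_T`: the closure in `L²([0,T], V)` of the complex linear span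
of the (classes of the) functions `x_t`, `t ∈ [0,T]`. -/
def kernelSpace (H T : ℝ) : Submodule ℂ (Lp ℂ 2 (varMeasure H T)) :=
  (Submodule.span ℂ
    {f : Lp ℂ 2 (varMeasure H T) |
      ∃ t ∈ Icc 0 T, f =ᵐ[varMeasure H T] movAvgKernel H t}).topologicalClosure

/-- The Bessel function of the first kind of order `ν`,
`J_ν(z) = (z/2)^ν ∑_k (-1)^k / (k! Γ(k+ν+1)) (z/2)^(2k)`, with the principal branch of the power. -/
def besselJ (ν z : ℂ) : ℂ :=
  (z / 2) ^ ν *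
    ∑' k : ℕ, (-1) ^ k / ((k.factorial : ℂ) * Complex.Gamma (k + ν + 1)) * (z / 2) ^ (2 * k)

/-- The Fourier kernel
`φ(z) = Γ(1-H) (z/4)^H exp(iz/2) (J_{-H}(z/2) + i J_{1-H}(z/2))` for `z ≠ 0`, and `φ(0) = 1`.
The principal branches of the powers cancel, so that this is the single-valued function of
`z ∈ ℂ`. -/
def fourierKernel (H : ℝ) (z : ℂ) : ℂ :=
  if z = 0 then 1
  else (Real.Gamma (1 - H) : ℂ) * (z / 4) ^ (H : ℂ) * Complex.exp (Complex.I * z / 2)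
    * (besselJ (-(H : ℂ)) (z / 2) + Complex.I * besselJ (1 - (H : ℂ)) (z / 2))

/-- `z ↦ ∫_0^T f(u) φ(uz) dV_u`. -/
def kernelTransform (H T : ℝ) (f : ℝ → ℂ) (z : ℂ) : ℂ :=
  ∫ u, f u * fourierKernel H (u * z) ∂(varMeasure H T)

end FBM

end

/-! Both families have the covariance of fractional Brownian motion as Gram matrix: `⟨x_t, x_s⟩` and
`⟨e_t, e_s⟩` are equal to `(t^(2H) + s^(2H) - |t-s|^(2H))/2`. Families with equal Gram matrices have
isometric closed spans, which gives `U`. To see that `U` is integration against `φ`, it suffices to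
compute the transform of each `x_t` and pass to the closure.

Kernel side. By homogeneity `x_t(u) = u^(2H-1) h(u/t)` with one profile `h`, and `u^(2H-1)` cancels
the density of `V`. The Mellin transform of `h` is a quotient of Gamma functions
(`integral_profile_mul`). Hence the normalised moments of `h` are `(2-2H)_n / ((3/2-H)_n (n+1))`
(`volConst_mul_moment`), and this is used twice. (a) Covariance: `x^(2H-1) h(x)` is a power series
plus a multiple of `x^(2H-1)`. Against the moments its coefficients become those of the binomial
series of `(1-r)^(2H)`, and the extra power gives `r^(2H)/2` (`profileCorr_of_lt_one`); the ratio `r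
= 1` is a limit. (b) Transform: Kummer's second theorem, in a contiguous form, turns the Bessel
expression into `φ(z) = ∑ (3/2-H)_n / (2-2H)_n (iz)^n / n!` (`fourierKernel_eq_tsum`). The moments
cancel the Pochhammer quotients, and `t ∑ (itl)^n / (n+1)! = e_t(l)` remains
(`kernelTransform_movAvgKernel`).

Spectral side. Two applications of Tonelli and the reflection formula give `∫ (1 - cos x) x^(-1-2H)
dx` over the half-line, hence `‖e_t - e_s‖² = |t-s|^(2H)`; polarisation and the symmetry `l ↦ -l`
give the covariance (`integral_expFun_mul_conj`).

Closure. For fixed `z` the map `f ↦ ∫ f(u) φ(uz) dV_u` is a bounded functional on `L²(V)`, since `φ`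
is bounded on compact sets and `V` is finite. An `L²` limit is an almost everywhere limit along a
subsequence, so the formula passes from the span to its closure (`isometry_ae_eq_kernelTransform`).
Differentiation under the integral makes the transform entire. -/

noncomputable section

/-! ### Power series of the Fourier kernel via Kummer's second theorem. -/

namespace FBM

/-- The quotient of Pochhammer symbols `(x)_n / (y)_n`. -/
def pochRatio (x y : ℝ) (n : ℕ) : ℝ := ∏ i ∈ Finset.range n, (x + i) / (y + i)

@[simp] lemma pochRatio_zero (x y : ℝ) : pochRatio x y 0 = 1 := by simp [pochRatio]

lemma pochRatio_succ (x y : ℝ) (n : ℕ) :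
    pochRatio x y (n + 1) = pochRatio x y n * ((x + n) / (y + n)) := by
  rw [pochRatio, Finset.prod_range_succ, pochRatio]

lemma pochRatio_pos {x y : ℝ} (hx : 0 < x) (hy : 0 < y) (n : ℕ) : 0 < pochRatio x y n :=
  Finset.prod_pos fun i _ => by positivity

lemma pochRatio_inv (x y : ℝ) (n : ℕ) : (pochRatio x y n)⁻¹ = pochRatio y x n := by
  simp [pochRatio]

lemma pochRatio_le {x y : ℝ} (hx : 0 < x) (hy : 0 < y) (n : ℕ) :
    pochRatio x y n ≤ (1 + x / y) ^ n := by
  induction n with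
  | zero => simp
  | succ n ih =>
    rw [pochRatio_succ, pow_succ]
    have : (x + n) / (y + n) ≤ 1 + x / y := by
      rw [div_le_iff₀ (by positivity)]
      have h1 : x / y * y = x := by field_simp
      have h2 : 0 ≤ x / y * n := by positivity
      nlinarith
    have := (pochRatio_pos hx hy n).le
    gcongr

/-- The power series coefficients of
`Γ(1-H) (w/2)^H (J_{-H} + i J_{1-H})(z/2)`, as a series in `w = iz/2`. -/
def besselCoeff (c : ℝ) (n : ℕ) : ℝ :=
  Real.Gamma c / (2 ^ n * (n / 2).factorial * Real.Gamma (((n + 1) / 2 : ℕ) + c))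

lemma besselCoeff_even (c : ℝ) (k : ℕ) :
    besselCoeff c (2 * k) = Real.Gamma c / (2 ^ (2 * k) * k.factorial * Real.Gamma (k + c)) := by
  have h1 : 2 * k / 2 = k := by omega
  have h2 : (2 * k + 1) / 2 = k := by omega
  rw [besselCoeff, h1, h2]

lemma besselCoeff_odd (c : ℝ) (k : ℕ) :
    besselCoeff c (2 * k + 1) =
      Real.Gamma c / (2 ^ (2 * k + 1) * k.factorial * Real.Gamma (k + 1 + c)) := by
  have h1 : (2 * k + 1) / 2 = k := by omega
  have h2 : (2 * k + 1 + 1) / 2 = k + 1 := by omega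
  rw [besselCoeff, h1, h2]
  push_cast
  rfl

lemma Gamma_nat_succ_add {c : ℝ} (hc : 0 < c) (k : ℕ) :
    Real.Gamma (k + 1 + c) = (k + c) * Real.Gamma (k + c) := by
  rw [show (k : ℝ) + 1 + c = (k + c) + 1 by ring, Real.Gamma_add_one (by positivity)]

lemma besselCoeff_zero {c : ℝ} (hc : 0 < c) : besselCoeff c 0 = 1 := by
  have := (Real.Gamma_pos_of_pos hc).ne'
  simp [besselCoeff, this]

lemma besselCoeff_one {c : ℝ} (hc : 0 < c) : 2 * c * besselCoeff c 1 = 1 := by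
  have h := (Real.Gamma_pos_of_pos hc).ne'
  have := besselCoeff_odd c 0
  have h2 := Gamma_nat_succ_add hc 0
  simp only [Nat.cast_zero, zero_add, mul_zero] at this h2
  rw [this, h2]
  have := hc.ne'
  simp
  field_simp

/-- This is the coefficient form of `w G'' + 2c G' = w G + G` for `G(w) = ∑ besselCoeff c n w^n`.
The even coefficients come from `J_{-H}` and the odd ones from `i J_{1-H}` (with `c = 1 - H`), so
each parity is checked separately with the functional equation of Gamma. -/
lemma besselCoeff_rec {c : ℝ} (hc : 0 < c) (m : ℕ) :
    (m + 2) * (m + 1 + 2 * c) * besselCoeff c (m + 2) = besselCoeff c (m + 1) + besselCoeff c m := by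
  have hk : ∀ k : ℕ, Real.Gamma (k + c) ≠ 0 := fun k => (Real.Gamma_pos_of_pos (by positivity)).ne'
  have hk' : ∀ k : ℕ, (k : ℝ) + c ≠ 0 := fun k => by positivity
  have hf : ∀ k : ℕ, (k.factorial : ℝ) ≠ 0 := fun k => by positivity
  obtain ⟨k, rfl | rfl⟩ := Nat.even_or_odd' m
  · rw [show 2 * k + 2 = 2 * (k + 1) by ring, besselCoeff_even, besselCoeff_odd, besselCoeff_even,
      Nat.factorial_succ]
    push_cast
    rw [Gamma_nat_succ_add hc]
    have := hk k; have := hk' k; have := hf k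
    have : (k : ℝ) + 1 ≠ 0 := by positivity
    field_simp
    ring
  · rw [show 2 * k + 1 + 2 = 2 * (k + 1) + 1 by ring, show 2 * k + 1 + 1 = 2 * (k + 1) by ring,
      besselCoeff_odd, besselCoeff_odd, besselCoeff_even, Nat.factorial_succ]
    push_cast
    have h1 := Gamma_nat_succ_add hc (k + 1)
    push_cast at h1
    rw [h1]
    have h3 := hk (k + 1); have h4 := hk' (k + 1); have := hf k
    push_cast at h3 h4
    have : (k : ℝ) + 1 ≠ 0 := by positivity
    field_simp
    ring

open PowerSeries in
/-- The contiguous form of Kummer's second theorem, on the level of coefficients. -/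
lemma sum_antidiagonal_besselCoeff {c : ℝ} (hc : 0 < c) (n : ℕ) :
    ∑ p ∈ Finset.HasAntidiagonal.antidiagonal n, (1 / (p.1.factorial : ℝ)) * besselCoeff c p.2 =
      2 ^ n / n.factorial * pochRatio (c + 1 / 2) (2 * c) n := by
  set G : PowerSeries ℝ := PowerSeries.mk (besselCoeff c) with hG
  set E : PowerSeries ℝ := PowerSeries.exp ℝ with hE
  have hsum : ∀ n, ∑ p ∈ Finset.HasAntidiagonal.antidiagonal n, (1 / (p.1.factorial : ℝ)) * besselCoeff c p.2 =
      coeff n (E * G) := by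
    intro n
    rw [PowerSeries.coeff_mul]
    refine Finset.sum_congr rfl fun p _ => ?_
    simp [hE, hG, PowerSeries.coeff_exp]
  have hDE : derivative ℝ E = E := PowerSeries.derivative_exp ℝ
  obtain ⟨b, hb⟩ : ∃ b, b = 2 * c := ⟨_, rfl⟩
  obtain ⟨d, hd⟩ : ∃ d, d = b + 1 := ⟨_, rfl⟩
  have hGode : X * derivative ℝ (derivative ℝ G) + C b * derivative ℝ G = X * G + G := by
    ext n
    rcases n with _ | m
    · have := besselCoeff_one hc
      have h0 := besselCoeff_zero hc
      simp only [map_add, PowerSeries.coeff_zero_X_mul, PowerSeries.coeff_C_mul,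
        PowerSeries.coeff_derivative, hG, PowerSeries.coeff_mk, hb]
      rw [h0]
      push_cast
      simp only [zero_add]
      linarith
    · have := besselCoeff_rec hc m
      simp only [map_add, PowerSeries.coeff_succ_X_mul, PowerSeries.coeff_C_mul,
        PowerSeries.coeff_derivative, hG, PowerSeries.coeff_mk, hb]
      push_cast
      linear_combination this
  -- Multiplication by the exponential removes the term without derivative and with factor `X`. The
  -- equation for `Y = E * G` therefore yields a two-term recursion, which is solved by a Pochhammer
  -- quotient.
  have hYode : X * derivative ℝ (derivative ℝ (E * G)) + C b * derivative ℝ (E * G) =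
      C 2 * (X * derivative ℝ (E * G)) + C d * (E * G) := by
    simp only [Derivation.leibniz, hDE, smul_eq_mul, map_add, map_one, hd, map_ofNat]
    linear_combination E * hGode
  have hrec : ∀ n : ℕ, (n + 1) * (n + 2 * c) * coeff (n + 1) (E * G) =
      (2 * n + 2 * c + 1) * coeff n (E * G) := by
    intro n
    have h := congrArg (coeff n) hYode
    generalize E * G = Y at h ⊢
    rcases n with _ | m
    · simp only [map_add, PowerSeries.coeff_C_mul, PowerSeries.coeff_zero_X_mul,
        PowerSeries.coeff_derivative] at h
      rw [hd, hb] at h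
      push_cast at h ⊢
      linear_combination h
    · simp only [map_add, PowerSeries.coeff_C_mul, PowerSeries.coeff_succ_X_mul,
        PowerSeries.coeff_derivative] at h
      rw [hd, hb] at h
      push_cast at h ⊢
      linear_combination h
  rw [hsum]
  induction n with
  | zero => simp [hE, hG, besselCoeff_zero hc]
  | succ n ih =>
    have h := hrec n
    rw [ih] at h
    have h1 : ((n : ℝ) + 1) * (n + 2 * c) ≠ 0 := by positivity
    have h2 : (n : ℝ) + 2 * c ≠ 0 := by positivity
    have h3 : (2 * c + n : ℝ) ≠ 0 := by positivity
    apply mul_left_cancel₀ h1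
    rw [h, pochRatio_succ, Nat.factorial_succ, pow_succ]
    have : (n.factorial : ℝ) ≠ 0 := by positivity
    push_cast
    field_simp
    ring

/-- Each step of the functional equation multiplies by `k + c ≥ c`. The bound is crude, but the
factorial in the coefficients alone ensures convergence. -/
lemma besselCoeff_bound {c : ℝ} (hc : 0 < c) (k : ℕ) : Real.Gamma c * c ^ k ≤ Real.Gamma (k + c) := by
  induction k with
  | zero => simp
  | succ k ih =>
    have h := Gamma_nat_succ_add hc k
    have hg := Real.Gamma_pos_of_pos hc
    push_cast
    rw [h, pow_succ, mul_comm ((k : ℝ) + c), ← mul_assoc]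
    have : c ≤ k + c := by simp
    gcongr

lemma besselCoeff_even_le {c : ℝ} (hc : 0 < c) (k : ℕ) :
    |besselCoeff c (2 * k)| ≤ (1 / (4 * c)) ^ k / k.factorial := by
  have hg := Real.Gamma_pos_of_pos hc
  have hb := besselCoeff_bound hc k
  have hG : 0 < Real.Gamma (k + c) := Real.Gamma_pos_of_pos (by positivity)
  rw [besselCoeff_even, abs_of_nonneg (by positivity), div_pow, one_pow, div_div, mul_pow,
    div_le_div_iff₀ (by positivity) (by positivity), pow_mul]
  norm_num
  calc Real.Gamma c * (4 ^ k * c ^ k * k.factorial)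
      = 4 ^ k * k.factorial * (Real.Gamma c * c ^ k) := by ring
    _ ≤ _ := by gcongr

lemma besselCoeff_odd_le {c : ℝ} (hc : 0 < c) (k : ℕ) :
    |besselCoeff c (2 * k + 1)| ≤ 1 / (2 * c) * ((1 / (4 * c)) ^ k / k.factorial) := by
  have hg := Real.Gamma_pos_of_pos hc
  have hb := besselCoeff_bound hc (k + 1)
  push_cast at hb
  have hG : 0 < Real.Gamma (k + 1 + c) := Real.Gamma_pos_of_pos (by positivity)
  rw [besselCoeff_odd, abs_of_nonneg (by positivity), div_pow, one_pow, div_div, mul_pow,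
    div_mul_div_comm, one_mul, div_le_div_iff₀ (by positivity) (by positivity), pow_succ, pow_mul]
  norm_num
  calc Real.Gamma c * (2 * c * (4 ^ k * c ^ k * k.factorial))
      = 4 ^ k * 2 * k.factorial * (Real.Gamma c * c ^ (k + 1)) := by ring
    _ ≤ _ := by gcongr

lemma summable_besselCoeff_even {c : ℝ} (hc : 0 < c) (w : ℂ) :
    Summable fun k : ℕ => ‖(besselCoeff c (2 * k) : ℂ) * w ^ (2 * k)‖ := by
  refine Summable.of_nonneg_of_le (fun _ => norm_nonneg _) (fun k => ?_)
    (Real.summable_pow_div_factorial (1 / (4 * c) * ‖w‖ ^ 2))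
  rw [norm_mul, norm_pow, Complex.norm_real, Real.norm_eq_abs, mul_pow, ← pow_mul, mul_div_right_comm]
  gcongr
  exact besselCoeff_even_le hc k

lemma summable_besselCoeff_odd {c : ℝ} (hc : 0 < c) (w : ℂ) :
    Summable fun k : ℕ => ‖(besselCoeff c (2 * k + 1) : ℂ) * w ^ (2 * k + 1)‖ := by
  refine Summable.of_nonneg_of_le (fun _ => norm_nonneg _) (fun k => ?_)
    ((Real.summable_pow_div_factorial (1 / (4 * c) * ‖w‖ ^ 2)).mul_left (1 / (2 * c) * ‖w‖))
  rw [norm_mul, norm_pow, Complex.norm_real, Real.norm_eq_abs]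
  calc _ ≤ 1 / (2 * c) * ((1 / (4 * c)) ^ k / k.factorial) * ‖w‖ ^ (2 * k + 1) := by
        gcongr; exact besselCoeff_odd_le hc k
    _ = _ := by rw [mul_pow, pow_succ, pow_mul]; ring

lemma summable_besselCoeff {c : ℝ} (hc : 0 < c) (w : ℂ) :
    Summable fun n : ℕ => ‖(besselCoeff c n : ℂ) * w ^ n‖ :=
  Summable.even_add_odd (summable_besselCoeff_even hc w) (summable_besselCoeff_odd hc w)

/-- The contiguous form of Kummer's second theorem. -/
lemma exp_mul_tsum_besselCoeff {c : ℝ} (hc : 0 < c) (w : ℂ) :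
    Complex.exp w * ∑' n, (besselCoeff c n : ℂ) * w ^ n =
      ∑' n : ℕ, (pochRatio (c + 1 / 2) (2 * c) n : ℂ) * (2 * w) ^ n / n.factorial := by
  have h1 : Summable fun n : ℕ => ‖w ^ n / (n.factorial : ℂ)‖ := NormedSpace.norm_expSeries_div_summable w
  rw [Complex.exp_eq_exp_ℂ, NormedSpace.exp_eq_tsum_div,
    tsum_mul_tsum_eq_tsum_sum_antidiagonal_of_summable_norm h1 (summable_besselCoeff hc w)]
  refine tsum_congr fun n => ?_
  have h := congrArg (fun x : ℝ => (x : ℂ) * w ^ n) (sum_antidiagonal_besselCoeff hc n)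
  push_cast at h
  rw [Finset.sum_mul] at h
  rw [mul_pow]
  refine Eq.trans (Finset.sum_congr rfl fun p hp => ?_) (h.trans (by ring))
  rw [← Finset.HasAntidiagonal.mem_antidiagonal.1 hp, pow_add]
  ring

/-- The power series of the Fourier kernel. -/
def kernelSeries (H : ℝ) (n : ℕ) (z : ℂ) : ℂ :=
  (pochRatio (3 / 2 - H) (2 - 2 * H) n : ℂ) * (Complex.I * z) ^ n / n.factorial

lemma I_mul_div_two_pow (z : ℂ) (k : ℕ) :
    (Complex.I * z / 2) ^ (2 * k) = 4 ^ k * ((-1) ^ k * (z / 4) ^ (2 * k)) := by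
  rw [pow_mul, pow_mul, ← mul_pow, ← mul_pow]
  congr 1
  rw [div_pow, mul_pow, Complex.I_sq]
  ring

/-- The prefactor `(z/4)^H` and the factor `(z/4)^(-H)` inside `J_{-H}(z/2)` are powers of the same
number on the same branch, so they cancel. The remaining even series is written in `w = iz/2`, which
absorbs the alternating signs. -/
lemma Gamma_mul_besselJ_neg (H : ℝ) {z : ℂ} (hz : z ≠ 0) :
    (Real.Gamma (1 - H) : ℂ) * (z / 4) ^ (H : ℂ) * besselJ (-(H : ℂ)) (z / 2) =
      ∑' k : ℕ, (besselCoeff (1 - H) (2 * k) : ℂ) * (Complex.I * z / 2) ^ (2 * k) := by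
  have hz4 : z / 4 ≠ 0 := by simpa using hz
  have h0 : (z / 4) ^ (H : ℂ) ≠ 0 := by simp [Complex.cpow_eq_zero_iff, hz]
  rw [besselJ, show z / 2 / 2 = z / 4 by ring, Complex.cpow_neg, mul_assoc,
    mul_inv_cancel_left₀ h0, ← tsum_mul_left]
  refine tsum_congr fun k => ?_
  rw [besselCoeff_even, I_mul_div_two_pow,
    show (k : ℂ) + -(H : ℂ) + 1 = ((k + (1 - H) : ℝ) : ℂ) by push_cast; ring,
    Complex.Gamma_ofReal, pow_mul 2]
  push_cast
  generalize (Real.Gamma (1 - H) : ℂ) = g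
  generalize (Real.Gamma (k + (1 - H)) : ℂ) = g'
  generalize (z / 4) ^ (2 * k) = y
  have h4 : (4 : ℂ) ^ k ≠ 0 := by simp
  rw [show (2 : ℂ) ^ 2 = 4 by norm_num, mul_assoc ((4 : ℂ) ^ k), mul_comm ((4 : ℂ) ^ k),
    ← mul_assoc _ ((4 : ℂ) ^ k), div_mul_eq_mul_div g, mul_div_mul_right _ _ h4]
  ring

/-- Here the two powers of `z/4` multiply to `z/4`, and `i z/4 = w/2` supplies the odd power of `w =
iz/2`. -/
lemma Gamma_mul_besselJ_one_sub (H : ℝ) {z : ℂ} (hz : z ≠ 0) :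
    (Real.Gamma (1 - H) : ℂ) * (z / 4) ^ (H : ℂ) * (Complex.I * besselJ (1 - (H : ℂ)) (z / 2)) =
      ∑' k : ℕ, (besselCoeff (1 - H) (2 * k + 1) : ℂ) * (Complex.I * z / 2) ^ (2 * k + 1) := by
  have hz4 : z / 4 ≠ 0 := by simpa using hz
  have h0 : (z / 4) ^ (H : ℂ) ≠ 0 := by simp [Complex.cpow_eq_zero_iff, hz]
  rw [besselJ, show z / 2 / 2 = z / 4 by ring, Complex.cpow_sub _ _ hz4, Complex.cpow_one,
    show ∀ g p S : ℂ, g * p * (Complex.I * (z / 4 / p * S)) = (g * Complex.I * (z / 4) * (p / p)) * S by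
      intros; ring, div_self h0, mul_one, ← tsum_mul_left]
  refine tsum_congr fun k => ?_
  rw [besselCoeff_odd, pow_succ (Complex.I * z / 2), I_mul_div_two_pow,
    show (k : ℂ) + (1 - (H : ℂ)) + 1 = ((k + 1 + (1 - H) : ℝ) : ℂ) by push_cast; ring,
    Complex.Gamma_ofReal, pow_succ 2, pow_mul 2]
  push_cast
  generalize (Real.Gamma (1 - H) : ℂ) = g
  generalize (Real.Gamma (k + 1 + (1 - H)) : ℂ) = g'
  generalize (z / 4) ^ (2 * k) = y
  have h4 : (4 : ℂ) ^ k ≠ 0 := by simp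
  rw [show (2 : ℂ) ^ 2 = 4 by norm_num, mul_assoc ((4 : ℂ) ^ k), mul_assoc ((4 : ℂ) ^ k),
    mul_comm ((4 : ℂ) ^ k), mul_assoc ((4 : ℂ) ^ k), ← mul_assoc _ ((4 : ℂ) ^ k),
    div_mul_eq_mul_div g, mul_div_mul_right _ _ h4]
  ring

lemma tsum_besselCoeff_even_add_odd {c : ℝ} (hc : 0 < c) (w : ℂ) :
    (∑' k : ℕ, (besselCoeff c (2 * k) : ℂ) * w ^ (2 * k)) +
      ∑' k : ℕ, (besselCoeff c (2 * k + 1) : ℂ) * w ^ (2 * k + 1) =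
    ∑' n : ℕ, (besselCoeff c n : ℂ) * w ^ n :=
  tsum_even_add_odd (f := fun n : ℕ => (besselCoeff c n : ℂ) * w ^ n)
    (summable_besselCoeff_even hc _).of_norm (summable_besselCoeff_odd hc _).of_norm

lemma kernelSeries_eq (H : ℝ) (n : ℕ) (z : ℂ) :
    (pochRatio (1 - H + 1 / 2) (2 * (1 - H)) n : ℂ) * (2 * (Complex.I * z / 2)) ^ n /
      n.factorial = kernelSeries H n z := by
  rw [kernelSeries, show 1 - H + 1 / 2 = 3 / 2 - H by ring,
    show 2 * (1 - H) = 2 - 2 * H by ring, mul_div_cancel₀ _ two_ne_zero]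

lemma fourierKernel_zero (H : ℝ) : fourierKernel H 0 = ∑' n, kernelSeries H n 0 := by
  have h0 : ∀ n : ℕ, n ≠ 0 → kernelSeries H n 0 = 0 := fun n hn => by
    rw [kernelSeries, mul_zero, zero_pow hn, mul_zero, zero_div]
  rw [fourierKernel, if_pos rfl, tsum_eq_single 0 h0, kernelSeries, pochRatio_zero]
  norm_num

/-- This identifies `φ(z)` with the confluent hypergeometric function `₁F₁(3/2-H; 2-2H; iz)`. It
shows that `φ` is entire, and its coefficients are matched later with the moments of the profile. -/
lemma fourierKernel_eq_tsum {H : ℝ} (hH1 : H < 1) (z : ℂ) :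
    fourierKernel H z = ∑' n, kernelSeries H n z := by
  have hc : 0 < 1 - H := by linarith
  rcases eq_or_ne z 0 with h | hz
  · rw [h, fourierKernel_zero]
  rw [← tsum_congr fun n => kernelSeries_eq H n z, ← exp_mul_tsum_besselCoeff hc,
    ← tsum_besselCoeff_even_add_odd hc, ← Gamma_mul_besselJ_neg H hz,
    ← Gamma_mul_besselJ_one_sub H hz, fourierKernel, if_neg hz]
  generalize besselJ (-(H : ℂ)) (z / 2) = x
  generalize besselJ (1 - (H : ℂ)) (z / 2) = y
  generalize (Real.Gamma (1 - H) : ℂ) = g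
  generalize (z / 4) ^ (H : ℂ) = p
  ring

lemma norm_kernelSeries_le {H : ℝ} (hH1 : H < 1) (n : ℕ) {z : ℂ} {R : ℝ} (hz : ‖z‖ ≤ R) :
    ‖kernelSeries H n z‖ ≤ ((1 + (3 / 2 - H) / (2 - 2 * H)) * R) ^ n / n.factorial := by
  have hp := pochRatio_pos (x := 3 / 2 - H) (y := 2 - 2 * H) (by linarith) (by linarith) n
  have hle := pochRatio_le (x := 3 / 2 - H) (y := 2 - 2 * H) (by linarith) (by linarith) n
  rw [kernelSeries, norm_div, norm_mul, norm_pow, norm_mul, Complex.norm_I, one_mul,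
    Complex.norm_real, Real.norm_of_nonneg hp.le, mul_pow, Complex.norm_natCast]
  have : 0 ≤ (3 / 2 - H) / (2 - 2 * H) := div_nonneg (by linarith) (by linarith)
  gcongr

lemma differentiable_fourierKernel {H : ℝ} (hH1 : H < 1) : Differentiable ℂ (fourierKernel H) := by
  intro z
  have h : DifferentiableOn ℂ (fun w => ∑' n, kernelSeries H n w) (Metric.ball 0 (‖z‖ + 1)) := by
    refine Complex.differentiableOn_tsum_of_summable_norm (Real.summable_pow_div_factorial
      ((1 + (3 / 2 - H) / (2 - 2 * H)) * (‖z‖ + 1))) (fun n => ?_) Metric.isOpen_ball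
      (fun n w hw => norm_kernelSeries_le hH1 n (by simpa using (mem_ball_zero_iff.1 hw).le))
    unfold kernelSeries
    fun_prop
  rw [show fourierKernel H = fun w => ∑' n, kernelSeries H n w from
    funext fun w => fourierKernel_eq_tsum hH1 w]
  exact h.differentiableAt (Metric.isOpen_ball.mem_nhds (by simp))

end FBM

end


/-! ### The kernels as dilates of one profile, and the Mellin transform of the profile. -/

noncomputable section

namespace FBM

section Beta

variable {p q : ℝ}

lemma ofReal_beta_integrand {p q x : ℝ} (hx : x ∈ Ioc (0 : ℝ) 1) :
    (x : ℂ) ^ (((p + 1 : ℝ) : ℂ) - 1) * (1 - (x : ℂ)) ^ (((q + 1 : ℝ) : ℂ) - 1) =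
      ((x ^ p * (1 - x) ^ q : ℝ) : ℂ) := by
  rw [Complex.ofReal_mul, Complex.ofReal_cpow hx.1.le, Complex.ofReal_cpow (by linarith [hx.2])]
  push_cast
  simp

lemma intervalIntegrable_beta (hp : -1 < p) (hq : -1 < q) :
    IntervalIntegrable (fun x : ℝ => x ^ p * (1 - x) ^ q) volume 0 1 := by
  have h := Complex.betaIntegral_convergent (u := ((p + 1 : ℝ) : ℂ)) (v := ((q + 1 : ℝ) : ℂ))
    (by rw [Complex.ofReal_re]; linarith) (by rw [Complex.ofReal_re]; linarith)
  rw [intervalIntegrable_iff_integrableOn_Ioc_of_le zero_le_one] at h ⊢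
  refine (IntegrableOn.congr_fun h.re (fun x hx => ?_) measurableSet_Ioc)
  simp only [ofReal_beta_integrand hx]
  simp

lemma integral_beta (hp : -1 < p) (hq : -1 < q) :
    ∫ x in (0 : ℝ)..1, x ^ p * (1 - x) ^ q =
      Real.Gamma (p + 1) * Real.Gamma (q + 1) / Real.Gamma (p + q + 2) := by
  have h := Complex.betaIntegral_eq_Gamma_mul_div ((p + 1 : ℝ) : ℂ) ((q + 1 : ℝ) : ℂ)
    (by rw [Complex.ofReal_re]; linarith) (by rw [Complex.ofReal_re]; linarith)
  rw [Complex.betaIntegral, intervalIntegral.integral_of_le zero_le_one,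
    setIntegral_congr_fun measurableSet_Ioc (fun x hx => ofReal_beta_integrand hx),
    ← Complex.ofReal_add, Complex.Gamma_ofReal, Complex.Gamma_ofReal, Complex.Gamma_ofReal,
    integral_complex_ofReal] at h
  rw [intervalIntegral.integral_of_le zero_le_one, show p + q + 2 = p + 1 + (q + 1) by ring]
  exact_mod_cast h

lemma integral_beta_succ (hp : -1 < p) (hq : -1 < q) :
    ∫ x in (0 : ℝ)..1, x ^ (p + 1) * (1 - x) ^ q =
      (p + 1) / (p + q + 2) * ∫ x in (0 : ℝ)..1, x ^ p * (1 - x) ^ q := by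
  rw [integral_beta hp hq, integral_beta (by linarith) hq, Real.Gamma_add_one (s := p + 1) (by linarith),
    show p + 1 + q + 2 = (p + q + 2) + 1 by ring, Real.Gamma_add_one (s := p + q + 2) (by linarith)]
  have h1 : Real.Gamma (p + q + 2) ≠ 0 := (Real.Gamma_pos_of_pos (by linarith)).ne'
  have h2 : p + q + 2 ≠ 0 := by linarith
  field_simp

end Beta

/-- The incomplete beta integral `∫_x^1 r^(1-2H) (1-r)^(H-1/2) dr`. -/
def betaTail (H x : ℝ) : ℝ := ∫ r in x..1, r ^ (1 - 2 * H) * (1 - r) ^ (H - 1 / 2)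

/-- The profile of the kernels `x_t`: `x_t(u) = u^(2H-1) h(u/t)` for `0 < u < t`. -/
def profile (H x : ℝ) : ℝ :=
  H * ((1 + x) * (x ^ (1 - 2 * H) * (1 - x) ^ (H - 1 / 2)) + (3 / 2 - H) * betaTail H x)

section Profile

variable {H : ℝ}

lemma betaTail_one : betaTail H 1 = 0 := by simp [betaTail]

lemma betaTail_integrable (hH0 : 0 < H) (hH1 : H < 1) :
    IntervalIntegrable (fun r : ℝ => r ^ (1 - 2 * H) * (1 - r) ^ (H - 1 / 2)) volume 0 1 :=
  intervalIntegrable_beta (by linarith) (by linarith)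

lemma betaTail_continuousOn (hH0 : 0 < H) (hH1 : H < 1) : ContinuousOn (betaTail H) (Icc 0 1) := by
  have h := betaTail_integrable hH0 hH1
  have := intervalIntegral.continuousOn_primitive_interval_left (a := 0) (b := 1)
    (μ := volume) (f := fun r : ℝ => r ^ (1 - 2 * H) * (1 - r) ^ (H - 1 / 2))
    (by rw [uIcc_of_le zero_le_one]
        exact (intervalIntegrable_iff_integrableOn_Icc_of_le zero_le_one).1 h)
  rwa [uIcc_of_le zero_le_one] at this

lemma continuousAt_beta {p q x : ℝ} (hx : x ∈ Ioo (0 : ℝ) 1) :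
    ContinuousAt (fun r : ℝ => r ^ p * (1 - r) ^ q) x := by
  have h1 : x ≠ 0 := hx.1.ne'
  have h2 : 1 - x ≠ 0 := by linarith [hx.2]
  exact (continuousAt_id.rpow_const (Or.inl h1)).mul
    ((continuousAt_const.sub continuousAt_id).rpow_const (Or.inl h2))

lemma hasDerivAt_betaTail (hH0 : 0 < H) (hH1 : H < 1) {x : ℝ} (hx : x ∈ Ioo (0 : ℝ) 1) :
    HasDerivAt (betaTail H) (-(x ^ (1 - 2 * H) * (1 - x) ^ (H - 1 / 2))) x := by
  have hcont : ContinuousOn (fun r : ℝ => r ^ (1 - 2 * H) * (1 - r) ^ (H - 1 / 2)) (Ioo 0 1) :=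
    fun y hy => (continuousAt_beta hy).continuousWithinAt
  refine intervalIntegral.integral_hasDerivAt_left
    ((betaTail_integrable hH0 hH1).mono_set ?_) ?_ (continuousAt_beta hx)
  · rw [uIcc_of_le hx.2.le, uIcc_of_le zero_le_one]
    exact Icc_subset_Icc_left hx.1.le
  · exact hcont.stronglyMeasurableAtFilter isOpen_Ioo x hx

lemma betaTail_nonneg {x : ℝ} (hx : x ∈ Icc (0 : ℝ) 1) : 0 ≤ betaTail H x := by
  refine intervalIntegral.integral_nonneg hx.2 fun r hr => ?_
  have h1 : 0 ≤ r := hx.1.trans hr.1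
  have h2 : 0 ≤ 1 - r := by linarith [hr.2]
  positivity

lemma betaTail_eq_sub (hH0 : 0 < H) (hH1 : H < 1) {x : ℝ} (hx : x ∈ Icc (0 : ℝ) 1) :
    betaTail H x = betaTail H 0 - ∫ r in (0 : ℝ)..x, r ^ (1 - 2 * H) * (1 - r) ^ (H - 1 / 2) := by
  have h := betaTail_integrable hH0 hH1
  rw [betaTail, betaTail, eq_sub_iff_add_eq, add_comm, intervalIntegral.integral_add_adjacent_intervals]
  · refine h.mono_set ?_
    rw [uIcc_of_le hx.1, uIcc_of_le zero_le_one]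
    exact Icc_subset_Icc_right hx.2
  · refine h.mono_set ?_
    rw [uIcc_of_le hx.2, uIcc_of_le zero_le_one]
    exact Icc_subset_Icc_left hx.1

lemma betaTail_le (hH0 : 0 < H) (hH1 : H < 1) {x : ℝ} (hx : x ∈ Icc (0 : ℝ) 1) :
    betaTail H x ≤ betaTail H 0 := by
  rw [betaTail_eq_sub hH0 hH1 hx, sub_le_self_iff]
  refine intervalIntegral.integral_nonneg hx.1 fun r hr => ?_
  have h1 : 0 ≤ r := hr.1
  have h2 : 0 ≤ 1 - r := by linarith [hr.2, hx.2]
  positivity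

lemma betaTail_zero (hH0 : 0 < H) (hH1 : H < 1) :
    betaTail H 0 = Real.Gamma (2 - 2 * H) * Real.Gamma (H + 1 / 2) / Real.Gamma (5 / 2 - H) := by
  rw [betaTail, integral_beta (by linarith) (by linarith)]
  ring_nf

lemma profile_nonneg (hH0 : 0 < H) (hH1 : H < 1) {x : ℝ} (hx : x ∈ Icc (0 : ℝ) 1) :
    0 ≤ profile H x := by
  have h1 : 0 ≤ x := hx.1
  have h2 : 0 ≤ 1 - x := by linarith [hx.2]
  have h3 := betaTail_nonneg (H := H) hx
  have h4 : 0 ≤ 3 / 2 - H := by linarith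
  unfold profile
  positivity

lemma profile_continuousOn (hH0 : 0 < H) (hH1 : H < 1) : ContinuousOn (profile H) (Ioo 0 1) := by
  have h1 : ContinuousOn (fun r : ℝ => r ^ (1 - 2 * H) * (1 - r) ^ (H - 1 / 2)) (Ioo 0 1) :=
    fun y hy => (continuousAt_beta hy).continuousWithinAt
  have h2 := (betaTail_continuousOn hH0 hH1).mono Ioo_subset_Icc_self
  unfold profile
  fun_prop

/-- The boundary integral in the definition of `x_t`, in terms of the incomplete beta integral. -/
lemma integral_movAvgKernel (hH0 : 0 < H) (hH1 : H < 1) {t u : ℝ} (hu : 0 < u) (hut : u < t) :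
    ∫ v in u..t, (2 * H - 1) * ((v - u) ^ (H - 1 / 2) * v ^ (H - 3 / 2)) =
      (t - u) ^ (H + 1 / 2) * t ^ (H - 3 / 2) -
        (3 / 2 - H) * u ^ (2 * H - 1) * betaTail H (u / t) := by
  have hH : 0 < H + 1 / 2 := by linarith
  have hmem : ∀ v ∈ Icc u t, u / v ∈ Icc (0 : ℝ) 1 := fun v hv => by
    have hv0 : 0 < v := hu.trans_le hv.1
    exact ⟨by positivity, (div_le_one hv0).2 hv.1⟩
  have hmem' : ∀ v ∈ Ioo u t, u / v ∈ Ioo (0 : ℝ) 1 := fun v hv => by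
    have hv0 : 0 < v := hu.trans hv.1
    exact ⟨by positivity, (div_lt_one hv0).2 hv.1⟩
  -- An explicit primitive in `v` that vanishes at `v = u`. Differentiating the product of powers
  -- leaves, besides the integrand, a term proportional to `u (v-u)^(H-1/2) v^(H-5/2)`; the
  -- substitution `r = u/v` in `betaTail` produces exactly this term.
  have key := intervalIntegral.integral_eq_sub_of_hasDerivAt_of_le
    (f := fun v => (v - u) ^ (H + 1 / 2) * v ^ (H - 3 / 2) -
        (3 / 2 - H) * u ^ (2 * H - 1) * betaTail H (u / v))
    (f' := fun v => (2 * H - 1) * ((v - u) ^ (H - 1 / 2) * v ^ (H - 3 / 2))) hut.le ?_ ?_ ?_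
  · rw [key, sub_self u, Real.zero_rpow hH.ne', div_self hu.ne', betaTail_one]
    ring
  · refine ContinuousOn.sub (ContinuousOn.mul ?_ ?_) (continuousOn_const.mul ?_)
    · exact ContinuousOn.rpow_const (by fun_prop) fun v hv => Or.inr hH.le
    · exact ContinuousOn.rpow_const (by fun_prop) fun v hv => Or.inl (hu.trans_le hv.1).ne'
    · exact (betaTail_continuousOn hH0 hH1).comp
        (continuousOn_const.div continuousOn_id fun v hv => (hu.trans_le hv.1).ne') hmem
  · intro v hv
    have hv0 : 0 < v := hu.trans hv.1
    have hvu : 0 < v - u := by linarith [hv.1]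
    have d1 : HasDerivAt (fun v : ℝ => (v - u) ^ (H + 1 / 2)) ((H + 1 / 2) * (v - u) ^ (H - 1 / 2)) v := by
      refine (((hasDerivAt_id' v).sub_const u).rpow_const (p := H + 1 / 2)
        (Or.inl hvu.ne')).congr_deriv ?_
      ring_nf
    have d2 : HasDerivAt (fun v : ℝ => v ^ (H - 3 / 2)) ((H - 3 / 2) * v ^ (H - 3 / 2 - 1)) v :=
      Real.hasDerivAt_rpow_const (Or.inl hv0.ne')
    have d3 : HasDerivAt (fun v : ℝ => u / v) (-u / v ^ 2) v := by
      refine ((hasDerivAt_inv hv0.ne').const_mul u).congr_deriv ?_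
      ring
    have d4 := (hasDerivAt_betaTail hH0 hH1 (hmem' v hv)).comp v d3
    refine ((d1.mul d2).sub (d4.const_mul ((3 / 2 - H) * u ^ (2 * H - 1)))).congr_deriv ?_
    have e1 : (1 - u / v) = (v - u) * v⁻¹ := by field_simp
    have e2 : (v - u) ^ (H + 1 / 2) = (v - u) ^ (H - 1 / 2) * (v - u) := by
      rw [← Real.rpow_add_one hvu.ne']; ring_nf
    have e3 : v ^ (H - 3 / 2) = v ^ (H - 3 / 2 - 1) * v := by
      rw [← Real.rpow_add_one hv0.ne']; ring_nf
    have e4 : u ^ (2 * H - 1) * ((u / v) ^ (1 - 2 * H) * (1 - u / v) ^ (H - 1 / 2)) =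
        (v - u) ^ (H - 1 / 2) * (v ^ (H - 3 / 2 - 1) * v ^ 2) := by
      rw [e1, div_eq_mul_inv, Real.mul_rpow hu.le (by positivity), Real.mul_rpow hvu.le (by positivity),
        Real.inv_rpow hv0.le, Real.inv_rpow hv0.le, ← Real.rpow_neg hv0.le, ← Real.rpow_neg hv0.le]
      have a1 : u ^ (2 * H - 1) * u ^ (1 - 2 * H) = 1 := by
        rw [← Real.rpow_add hu]; norm_num
      have a2 : v ^ (-(1 - 2 * H)) * v ^ (-(H - 1 / 2)) = v ^ (H - 3 / 2 - 1) * v ^ 2 := by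
        rw [← Real.rpow_add hv0, ← Real.rpow_natCast v 2, ← Real.rpow_add hv0]
        congr 1; push_cast; ring
      rw [← a2]
      linear_combination (v ^ (-(1 - 2 * H)) * (v - u) ^ (H - 1 / 2) * v ^ (-(H - 1 / 2))) * a1
    have e5 : (3 / 2 - H) * u ^ (2 * H - 1) *
        (-((u / v) ^ (1 - 2 * H) * (1 - u / v) ^ (H - 1 / 2)) * (-u / v ^ 2)) =
        (3 / 2 - H) * u * ((v - u) ^ (H - 1 / 2) * v ^ (H - 3 / 2 - 1)) := by
      have : v ^ 2 ≠ 0 := by positivity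
      calc _ = (3 / 2 - H) * u / v ^ 2 * (u ^ (2 * H - 1) *
            ((u / v) ^ (1 - 2 * H) * (1 - u / v) ^ (H - 1 / 2))) := by ring
        _ = _ := by rw [e4]; field_simp
    rw [e5, e2, e3]
    ring
  · have h1 : IntervalIntegrable (fun v : ℝ => (v - u) ^ (H - 1 / 2)) volume u t := by
      have := (intervalIntegral.intervalIntegrable_rpow' (a := 0) (b := t - u)
        (show -1 < H - 1 / 2 by linarith)).comp_sub_right u
      simpa using this
    refine (h1.mul_continuousOn ?_).const_mul _
    refine ContinuousOn.rpow_const (by fun_prop) fun v hv => Or.inl ?_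
    rw [uIcc_of_le hut.le] at hv
    exact (hu.trans_le hv.1).ne'

/-- The factor `u^(2H-1)` is split off because it cancels the density `u^(1-2H)` of `V`; the rest
depends on `u/t` only. -/
lemma movAvgKernel_eq (hH0 : 0 < H) (hH1 : H < 1) {t u : ℝ} (hu : 0 < u) (hut : u < t) :
    movAvgKernel H t u = ((u ^ (2 * H - 1) * profile H (u / t) : ℝ) : ℂ) := by
  have ht : 0 < t := hu.trans hut
  have htu : 0 < t - u := by linarith
  rw [movAvgKernel, indicator_of_mem (show u ∈ Ioo 0 t from ⟨hu, hut⟩)]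
  congr 1
  have hI := integral_movAvgKernel hH0 hH1 hu hut
  rw [intervalIntegral.integral_const_mul] at hI
  have e0 : ∫ v in u..t, (v - u) ^ (H - 1 / 2) * ((H - 1 / 2) * v ^ (H - 3 / 2)) =
      (H - 1 / 2) * ∫ v in u..t, (v - u) ^ (H - 1 / 2) * v ^ (H - 3 / 2) := by
    rw [← intervalIntegral.integral_const_mul]
    congr 1; ext v; ring
  have e2 : (t - u) ^ (H + 1 / 2) = (t - u) ^ (H - 1 / 2) * (t - u) := by
    rw [← Real.rpow_add_one htu.ne']; ring_nf
  have e3 : t ^ (H - 1 / 2) = t ^ (H - 3 / 2) * t := by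
    rw [← Real.rpow_add_one ht.ne']; ring_nf
  have e4 : u ^ (2 * H - 1) * ((1 + u / t) * ((u / t) ^ (1 - 2 * H) * (1 - u / t) ^ (H - 1 / 2))) =
      (t - u) ^ (H - 1 / 2) * t ^ (H - 3 / 2) * (t + u) := by
    rw [show 1 - u / t = (t - u) * t⁻¹ by field_simp, show 1 + u / t = (t + u) * t⁻¹ by field_simp,
      div_eq_mul_inv, Real.mul_rpow hu.le (by positivity), Real.mul_rpow htu.le (by positivity),
      Real.inv_rpow ht.le, Real.inv_rpow ht.le, ← Real.rpow_neg ht.le, ← Real.rpow_neg ht.le]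
    have a1 : u ^ (2 * H - 1) * u ^ (1 - 2 * H) = 1 := by
      rw [← Real.rpow_add hu]; norm_num
    have a2 : t⁻¹ * t ^ (-(1 - 2 * H)) * t ^ (-(H - 1 / 2)) = t ^ (H - 3 / 2) := by
      rw [← Real.rpow_neg_one, ← Real.rpow_add ht, ← Real.rpow_add ht]
      congr 1; ring
    rw [← a2]
    linear_combination ((t + u) * t⁻¹ * t ^ (-(1 - 2 * H)) * (t - u) ^ (H - 1 / 2) *
      t ^ (-(H - 1 / 2))) * a1
  rw [e0, profile]
  rw [e2] at hI
  rw [e3]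
  linear_combination -H * hI - H * e4

lemma movAvgKernel_eq_zero {t u : ℝ} (h : u ∉ Ioo 0 t) : movAvgKernel H t u = 0 :=
  indicator_of_notMem h _

lemma intervalIntegrable_betaTail_mul (hH0 : 0 < H) (hH1 : H < 1) {s : ℝ} (hs : -1 < s) :
    IntervalIntegrable (fun x : ℝ => betaTail H x * x ^ s) volume 0 1 := by
  refine (intervalIntegral.intervalIntegrable_rpow' hs).continuousOn_mul ?_
  rw [uIcc_of_le zero_le_one]
  exact betaTail_continuousOn hH0 hH1

/-- Integration by parts: the boundary term `x^(s+1) betaTail H x` vanishes at `0` because `s > -1`,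
and at `1` because the tail does. -/
lemma integral_betaTail_mul (hH0 : 0 < H) (hH1 : H < 1) {s : ℝ} (hs : -1 < s)
    (hs' : -1 < 1 - 2 * H + s) :
    ∫ x in (0 : ℝ)..1, betaTail H x * x ^ s =
      (1 / (s + 1)) * ∫ x in (0 : ℝ)..1, x ^ (1 - 2 * H + s + 1) * (1 - x) ^ (H - 1 / 2) := by
  have hs1 : 0 < s + 1 := by linarith
  have i1 := (intervalIntegrable_betaTail_mul hH0 hH1 hs).const_mul (s + 1)
  have i2 := intervalIntegrable_beta (p := 1 - 2 * H + s + 1) (q := H - 1 / 2) (by linarith) (by linarith)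
  have key := intervalIntegral.integral_eq_sub_of_hasDerivAt_of_le
    (f := fun x => x ^ (s + 1) * betaTail H x)
    (f' := fun x => (s + 1) * (betaTail H x * x ^ s) -
      x ^ (1 - 2 * H + s + 1) * (1 - x) ^ (H - 1 / 2)) zero_le_one ?_ ?_ (i1.sub i2)
  · rw [intervalIntegral.integral_sub i1 i2, intervalIntegral.integral_const_mul, betaTail_one,
      Real.zero_rpow hs1.ne', mul_zero, zero_mul, sub_zero, sub_eq_zero] at key
    rw [← key]
    field_simp
  · exact (continuousOn_id.rpow_const fun x _ => Or.inr hs1.le).mul (betaTail_continuousOn hH0 hH1)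
  · intro x hx
    have d1 : HasDerivAt (fun x : ℝ => x ^ (s + 1)) ((s + 1) * x ^ (s + 1 - 1)) x :=
      Real.hasDerivAt_rpow_const (Or.inl hx.1.ne')
    refine (d1.mul (hasDerivAt_betaTail hH0 hH1 hx)).congr_deriv ?_
    have e : x ^ (1 - 2 * H + s + 1) = x ^ (s + 1) * x ^ (1 - 2 * H) := by
      rw [← Real.rpow_add hx.1]; ring_nf
    rw [e, add_sub_cancel_right]
    ring

lemma profile_mul_rpow {s x : ℝ} (hx : x ∈ Ioo (0 : ℝ) 1) :
    profile H x * x ^ s =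
      H * (x ^ (1 - 2 * H + s) * (1 - x) ^ (H - 1 / 2) +
        x ^ (1 - 2 * H + s + 1) * (1 - x) ^ (H - 1 / 2) + (3 / 2 - H) * (betaTail H x * x ^ s)) := by
  rw [profile, Real.rpow_add_one hx.1.ne', Real.rpow_add hx.1]
  ring

lemma intervalIntegrable_congr_Ioo {E : Type*} [NormedAddCommGroup E] {f g : ℝ → E} {a b : ℝ}
    (hab : a ≤ b) (h : ∀ x ∈ Ioo a b, f x = g x) (hg : IntervalIntegrable g volume a b) :
    IntervalIntegrable f volume a b := by
  rw [intervalIntegrable_iff_integrableOn_Ioo_of_le hab] at hg ⊢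
  exact hg.congr_fun (fun x hx => (h x hx).symm) measurableSet_Ioo

lemma integral_congr_Ioo {E : Type*} [NormedAddCommGroup E] [NormedSpace ℝ E] {f g : ℝ → E} {a b : ℝ}
    (hab : a ≤ b) (h : ∀ x ∈ Ioo a b, f x = g x) :
    ∫ x in a..b, f x = ∫ x in a..b, g x := by
  rw [intervalIntegral.integral_of_le hab, intervalIntegral.integral_of_le hab,
    integral_Ioc_eq_integral_Ioo, integral_Ioc_eq_integral_Ioo]
  exact setIntegral_congr_fun measurableSet_Ioo h

lemma intervalIntegrable_profile_mul (hH0 : 0 < H) (hH1 : H < 1) {s : ℝ} (hs : -1 < s)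
    (hs' : -1 < 1 - 2 * H + s) :
    IntervalIntegrable (fun x : ℝ => profile H x * x ^ s) volume 0 1 := by
  refine intervalIntegrable_congr_Ioo zero_le_one (fun x hx => profile_mul_rpow hx) ?_
  exact (((intervalIntegrable_beta hs' (by linarith)).add
    (intervalIntegrable_beta (by linarith) (by linarith))).add
    ((intervalIntegrable_betaTail_mul hH0 hH1 hs).const_mul _)).const_mul _

/-- All three pieces of the profile reduce to one beta integral, and their rational prefactors
combine into a single fraction. The exponents needed later are `s = n` and `s = 2H - 1`. -/
lemma integral_profile_mul (hH0 : 0 < H) (hH1 : H < 1) {s : ℝ} (hs : -1 < s)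
    (hs' : -1 < 1 - 2 * H + s) :
    ∫ x in (0 : ℝ)..1, profile H x * x ^ s =
      2 * H * Real.Gamma (s + 2 - 2 * H) * Real.Gamma (H + 1 / 2) /
        ((s + 1) * Real.Gamma (s + 3 / 2 - H)) := by
  have i1 := intervalIntegrable_beta (q := H - 1 / 2) hs' (by linarith)
  have i2 := intervalIntegrable_beta (p := 1 - 2 * H + s + 1) (q := H - 1 / 2) (by linarith) (by linarith)
  have i3 := (intervalIntegrable_betaTail_mul hH0 hH1 hs).const_mul (3 / 2 - H)
  rw [integral_congr_Ioo zero_le_one (fun x hx => profile_mul_rpow hx),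
    intervalIntegral.integral_const_mul, intervalIntegral.integral_add (i1.add i2) i3,
    intervalIntegral.integral_add i1 i2, intervalIntegral.integral_const_mul,
    integral_betaTail_mul hH0 hH1 hs hs', integral_beta_succ hs' (by linarith),
    integral_beta hs' (by linarith)]
  have h0 : 0 < s + 3 / 2 - H := by linarith
  rw [show 1 - 2 * H + s + (H - 1 / 2) + 2 = (s + 3 / 2 - H) + 1 by ring,
    Real.Gamma_add_one h0.ne', show 1 - 2 * H + s + 1 = s + 2 - 2 * H by ring,
    show H - 1 / 2 + 1 = H + 1 / 2 by ring]
  have h1 := (Real.Gamma_pos_of_pos h0).ne'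
  have h2 : s + 1 ≠ 0 := by linarith
  have h3 : s + 3 / 2 - H + 1 ≠ 0 := by linarith
  have h4 := h0.ne'
  generalize Real.Gamma (s + 3 / 2 - H) = g1 at *
  generalize Real.Gamma (s + 2 - 2 * H) = g2 at *
  generalize Real.Gamma (H + 1 / 2) = g3 at *
  clear i1 i2 i3
  -- The denominators become the free variables, and `H` and `s` are expressed through them.
  generalize hA : s + 3 / 2 - H = A at *
  generalize hB : s + 1 = B at *
  obtain rfl : H = B + 1 / 2 - A := by linarith
  obtain rfl : s = B - 1 := by linarith
  field_simp
  ring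

end Profile

end FBM

end


/-! ### Taylor expansion of the profile and its normalised moments. -/

noncomputable section

namespace FBM

lemma _root_.HasSum.congr_terms {E : Type*} [AddCommMonoid E] [TopologicalSpace E] {f g : ℕ → E}
    {a b : E} (h : HasSum g b) (hf : ∀ n, f n = g n) (hab : a = b) : HasSum f a := by
  rw [funext hf, hab]
  exact h

/-- Dominated convergence with majorants `‖w‖ * u n`. Only the weight may be singular at the
endpoints, and it need only be integrable; the series is controlled uniformly on the open interval.
-/
lemma hasSum_integral_smul {E : Type*} [NormedAddCommGroup E] [NormedSpace ℝ E] {w : ℝ → ℝ}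
    {a b : ℝ} (hab : a ≤ b) (hw : IntervalIntegrable w volume a b) {g : ℕ → ℝ → E} {G : ℝ → E}
    (hg : ∀ n, Continuous (g n)) {u : ℕ → ℝ} (hu : Summable u)
    (hgu : ∀ n, ∀ x ∈ Ioo a b, ‖g n x‖ ≤ u n)
    (hG : ∀ x ∈ Ioo a b, HasSum (fun n => g n x) (G x)) :
    HasSum (fun n => ∫ x in a..b, w x • g n x) (∫ x in a..b, w x • G x) := by
  rw [intervalIntegrable_iff_integrableOn_Ioo_of_le hab] at hw
  simp only [intervalIntegral.integral_of_le hab, integral_Ioc_eq_integral_Ioo]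
  refine hasSum_integral_of_dominated_convergence (fun n x => ‖w x‖ * u n)
    (fun n => hw.aestronglyMeasurable.smul (hg n).aestronglyMeasurable) (fun n => ?_) ?_ ?_ ?_
  · refine (ae_restrict_iff' measurableSet_Ioo).2 (Filter.Eventually.of_forall fun x hx => ?_)
    rw [norm_smul]
    exact mul_le_mul_of_nonneg_left (hgu n x hx) (norm_nonneg _)
  · exact Filter.Eventually.of_forall fun x => hu.mul_left _
  · simp only [tsum_mul_left]
    exact hw.norm.mul_const _
  · refine (ae_restrict_iff' measurableSet_Ioo).2 (Filter.Eventually.of_forall fun x hx => ?_)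
    exact (hG x hx).const_smul _

/-- The binomial series. -/
lemma hasSum_pochRatio_one (α : ℝ) {x : ℝ} (hx : |x| < 1) :
    HasSum (fun n => pochRatio α 1 n * x ^ n) ((1 - x) ^ (-α)) := by
  -- Since `(1)_n = n!`, `pochRatio α 1 n` is `(α)_n / n!`, the multichoose coefficient.
  have hc : ∀ n : ℕ, Ring.choose (α + n - 1) n = pochRatio α 1 n := by
    intro n
    have h := Ring.factorial_nsmul_multichoose_eq_ascPochhammer α n
    rw [← Ring.multichoose_eq, Polynomial.ascPochhammer_smeval_eq_eval, nsmul_eq_mul] at *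
    have h2 : ∀ n : ℕ, (ascPochhammer ℝ n).eval α = n.factorial * pochRatio α 1 n := by
      intro n
      induction n with
      | zero => simp
      | succ n ih =>
        rw [ascPochhammer_succ_eval, ih, pochRatio_succ, Nat.factorial_succ]
        push_cast
        field_simp
        ring
    rw [h2] at h
    exact mul_left_cancel₀ (by positivity) h
  have h := (Real.one_div_one_sub_rpow_hasFPowerSeriesOnBall_zero α).hasSum (y := x)
    (by simpa [enorm_eq_nnnorm, ← NNReal.coe_lt_one] using hx)
  simp only [zero_add, hc, FormalMultilinearSeries.ofScalars_apply_eq, smul_eq_mul] at h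
  rw [Real.rpow_neg (by linarith [(abs_lt.1 hx).2]), ← one_div]
  exact h

/-- The Taylor coefficients of `x^(2H-1) (h(x) - A)`. -/
def profileCoeff (H : ℝ) (n : ℕ) : ℝ :=
  -(1 / 2) * (n + 1) * pochRatio (3 / 2 - H) (2 - 2 * H) n * pochRatio (-(2 * H)) 1 (n + 1)

variable {H : ℝ}

lemma profileCoeff_zero : profileCoeff H 0 = H := by
  simp [profileCoeff, pochRatio_succ]

/-- In `(-2H)_(n+2) = (-2H)(1-2H)(2-2H)_n` the last factor cancels the denominator `(2-2H)_(n+1)` up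
to one term, and `1-2H = 2(1/2-H)` completes `(3/2-H)_(n+1)` to `(1/2-H)_(n+2)`. What remains is
built on the coefficients of `(1-x)^(H-1/2)`. -/
lemma profileCoeff_succ' (hH1 : H < 1) (n : ℕ) : profileCoeff H (n + 1) =
    2 * H * pochRatio (1 / 2 - H) 1 n *
      ((n + 1 / 2 - H) * (n + (3 / 2 - H)) / ((n + 1) * (n + (2 - 2 * H)))) := by
  have hb : ∀ n : ℕ, (n : ℝ) + (2 - 2 * H) ≠ 0 := fun n => by
    have : (0 : ℝ) ≤ n := n.cast_nonneg
    linarith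
  induction n with
  | zero =>
    have h0 := hb 0
    simp only [profileCoeff, pochRatio_succ, pochRatio_zero]
    push_cast
    have : (2 - 2 * H + 0) ≠ 0 := by linarith
    simp only [Nat.cast_zero, zero_add] at h0
    field_simp
    ring
  | succ n ih =>
    have e : profileCoeff H (n + 1 + 1) = profileCoeff H (n + 1) *
        ((n + 1 + (3 / 2 - H)) / (n + 1 + (2 - 2 * H)) * ((n + (2 - 2 * H)) / (n + 2))) := by
      have h1 := hb (n + 1)
      push_cast at h1
      rw [profileCoeff, profileCoeff, pochRatio_succ _ _ (n + 1), pochRatio_succ _ _ (n + 1 + 1)]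
      generalize pochRatio (3 / 2 - H) (2 - 2 * H) (n + 1) = p1
      generalize pochRatio (-(2 * H)) 1 (n + 1 + 1) = p2
      push_cast
      rw [show 3 / 2 - H + ((n : ℝ) + 1) = n + 1 + (3 / 2 - H) by ring,
        show 2 - 2 * H + ((n : ℝ) + 1) = n + 1 + (2 - 2 * H) by ring,
        show -(2 * H) + ((n : ℝ) + 1 + 1) = n + (2 - 2 * H) by ring]
      have h2 : (n : ℝ) + 1 + 1 ≠ 0 := by positivity
      have h3 : 1 + ((n : ℝ) + 1 + 1) ≠ 0 := by positivity
      have h4 : (n : ℝ) + 2 ≠ 0 := by positivity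
      generalize (n : ℝ) + 1 + (2 - 2 * H) = y at *
      generalize (n : ℝ) + (2 - 2 * H) = y' at *
      field_simp
      ring
    rw [e, ih, pochRatio_succ]
    have h0 := hb n
    have h1 := hb (n + 1)
    push_cast at h1 ⊢
    generalize pochRatio (1 / 2 - H) 1 n = p
    have h2 : (n : ℝ) + 1 + 1 ≠ 0 := by positivity
    have h4 : (n : ℝ) + 2 ≠ 0 := by positivity
    have h5 : (n : ℝ) + 1 ≠ 0 := by positivity
    have h6 : 1 + (n : ℝ) ≠ 0 := by positivity
    rw [show (n : ℝ) + 1 + 1 / 2 - H = n + (3 / 2 - H) by ring]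
    generalize (n : ℝ) + 1 + (2 - 2 * H) = y at *
    generalize (n : ℝ) + (2 - 2 * H) = y' at *
    field_simp
    ring

lemma profileCoeff_succ (hH1 : H < 1) (n : ℕ) : profileCoeff H (n + 1) =
    H * (pochRatio (1 / 2 - H) 1 (n + 1) + pochRatio (1 / 2 - H) 1 n -
      (3 / 2 - H) * (pochRatio (1 / 2 - H) 1 n / (n + 2 - 2 * H))) := by
  have hb : (n : ℝ) + 2 - 2 * H ≠ 0 := by
    have : (0 : ℝ) ≤ n := n.cast_nonneg
    linarith
  have h5 : (n : ℝ) + 1 ≠ 0 := by positivity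
  have h6 : 1 + (n : ℝ) ≠ 0 := by positivity
  rw [profileCoeff_succ' hH1, pochRatio_succ, show (n : ℝ) + (2 - 2 * H) = n + 2 - 2 * H by ring]
  generalize pochRatio (1 / 2 - H) 1 n = p
  generalize hy : (n : ℝ) + 2 - 2 * H = y at *
  obtain rfl : H = (n + 2 - y) / 2 := by linarith
  field_simp
  ring

/-- The binomial series of `(1-r)^(H-1/2)` is integrated termwise against `r^(1-2H)`; the outer
power makes the result an ordinary power series. -/
lemma hasSum_incompleteBeta (hH1 : H < 1) {x : ℝ} (hx : x ∈ Ioo (0 : ℝ) 1) :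
    HasSum (fun n : ℕ => pochRatio (1 / 2 - H) 1 n / (n + 2 - 2 * H) * x ^ (n + 1))
      (x ^ (2 * H - 1) * ∫ r in (0 : ℝ)..x, r ^ (1 - 2 * H) * (1 - r) ^ (H - 1 / 2)) := by
  have hx0 : 0 < x := hx.1
  have hsum := (hasSum_pochRatio_one (1 / 2 - H) (x := x) (by rw [abs_of_pos hx0]; exact hx.2)).summable.abs
  have h := hasSum_integral_smul hx0.le (w := fun r => r ^ (1 - 2 * H))
    (intervalIntegral.intervalIntegrable_rpow' (by linarith))
    (g := fun n r => pochRatio (1 / 2 - H) 1 n * r ^ n) (G := fun r => (1 - r) ^ (H - 1 / 2))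
    (fun n => by fun_prop) hsum
    (fun n r hr => by
      rw [norm_mul, abs_mul, norm_pow, abs_pow, Real.norm_eq_abs, Real.norm_eq_abs, abs_of_pos hr.1,
        abs_of_pos hx0]
      have := hr.1.le
      have := hr.2.le
      gcongr)
    (fun r hr => by
      have := hasSum_pochRatio_one (1 / 2 - H) (x := r)
        (by rw [abs_of_pos hr.1]; exact hr.2.trans hx.2)
      rwa [neg_sub] at this)
  refine (h.mul_left (x ^ (2 * H - 1))).congr_terms (fun n => ?_) rfl
  have e : ∫ r in (0 : ℝ)..x, r ^ (1 - 2 * H) • (pochRatio (1 / 2 - H) 1 n * r ^ n) =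
      pochRatio (1 / 2 - H) 1 n * ∫ r in (0 : ℝ)..x, r ^ (1 - 2 * H + n) := by
    rw [← intervalIntegral.integral_const_mul]
    refine integral_congr_Ioo hx0.le fun r hr => ?_
    rw [Real.rpow_add_natCast hr.1.ne', smul_eq_mul]
    ring
  have hn : (0 : ℝ) ≤ n := n.cast_nonneg
  rw [e, integral_rpow (Or.inl (by linarith)), Real.zero_rpow (by linarith), sub_zero,
    show 1 - 2 * H + n + 1 = n + 2 - 2 * H by ring]
  have e2 : x ^ (2 * H - 1) * x ^ (n + 2 - 2 * H) = x ^ (n + 1) := by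
    rw [← Real.rpow_add hx0, ← Real.rpow_natCast]
    congr 1; push_cast; ring
  rw [← e2]
  ring

/-- Writing the tail as the complete integral minus the integral over `(0,x)` isolates the only term
that need not be a power series, a constant multiple of `x^(2H-1)`. -/
lemma hasSum_profileCoeff (hH0 : 0 < H) (hH1 : H < 1) {x : ℝ} (hx : x ∈ Ioo (0 : ℝ) 1) :
    HasSum (fun n : ℕ => profileCoeff H n * x ^ n)
      (x ^ (2 * H - 1) * profile H x - H * (3 / 2 - H) * betaTail H 0 * x ^ (2 * H - 1)) := by
  have h1 := hasSum_pochRatio_one (1 / 2 - H) (x := x) (by rw [abs_of_pos hx.1]; exact hx.2)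
  have h2 := hasSum_incompleteBeta hH1 hx
  have h3 := (hasSum_nat_add_iff' 1).2 h1
  have h4 := ((h3.add (h1.mul_left x)).sub (h2.mul_left (3 / 2 - H))).mul_left H
  rw [← hasSum_nat_add_iff' 1]
  refine h4.congr_terms (fun n => ?_) ?_
  · rw [profileCoeff_succ hH1]
    ring
  · simp only [Finset.range_one, Finset.sum_singleton, profileCoeff_zero, pochRatio_zero, pow_zero,
      neg_sub]
    have a1 : x ^ (2 * H - 1) * x ^ (1 - 2 * H) = 1 := by
      rw [← Real.rpow_add hx.1]; norm_num
    rw [profile, betaTail_eq_sub hH0 hH1 ⟨hx.1.le, hx.2.le⟩]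
    linear_combination H * (1 + x) * (1 - x) ^ (H - 1 / 2) * a1

/-- The total mass constant of `dV`. -/
def volConst (H : ℝ) : ℝ := dSq H * (2 - 2 * H)

lemma volConst_eq (hH0 : 0 < H) (hH1 : H < 1) : volConst H =
    Real.Gamma (3 / 2 - H) / (2 * H * Real.Gamma (H + 1 / 2) * Real.Gamma (2 - 2 * H)) := by
  rw [volConst, dSq, show 3 - 2 * H = (2 - 2 * H) + 1 by ring, Real.Gamma_add_one (by linarith)]
  have h1 : 2 - 2 * H ≠ 0 := by linarith
  have h2 := (Real.Gamma_pos_of_pos (show 0 < 2 - 2 * H by linarith)).ne'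
  have h3 := (Real.Gamma_pos_of_pos (show 0 < H + 1 / 2 by linarith)).ne'
  generalize Real.Gamma (3 / 2 - H) = g2 at *
  generalize Real.Gamma (H + 1 / 2) = g3 at *
  generalize Real.Gamma (2 - 2 * H) = g4 at *
  generalize 2 - 2 * H = y at *
  field_simp

lemma volConst_pos (hH0 : 0 < H) (hH1 : H < 1) : 0 < volConst H := by
  rw [volConst_eq hH0 hH1]
  have h2 := (Real.Gamma_pos_of_pos (show 0 < 2 - 2 * H by linarith))
  have h3 := (Real.Gamma_pos_of_pos (show 0 < H + 1 / 2 by linarith))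
  have h4 := (Real.Gamma_pos_of_pos (show 0 < 3 / 2 - H by linarith))
  positivity

lemma Gamma_add_nat_div {x : ℝ} (hx : 0 < x) (n : ℕ) {y : ℝ} (hy : 0 < y) :
    Real.Gamma (n + x) * Real.Gamma y = pochRatio x y n * (Real.Gamma x * Real.Gamma (n + y)) := by
  induction n with
  | zero => simp
  | succ n ih =>
    have h1 := Gamma_nat_succ_add hx n
    have h2 := Gamma_nat_succ_add hy n
    push_cast
    rw [h1, h2, pochRatio_succ]
    have : y + n ≠ 0 := by positivity
    field_simp
    linear_combination (n + x) * (n + y) * ih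

/-- The constant `d_H²` normalises the moment for `n = 0` to `1`. The quotient is the reciprocal of
the one in the series of `φ`, and this is the reason why `φ` carries `x_t` to `e_t`. -/
lemma volConst_mul_moment (hH0 : 0 < H) (hH1 : H < 1) (n : ℕ) :
    volConst H * ∫ x in (0 : ℝ)..1, profile H x * x ^ n =
      pochRatio (2 - 2 * H) (3 / 2 - H) n / (n + 1) := by
  have hn : (0 : ℝ) ≤ n := n.cast_nonneg
  have h := integral_profile_mul hH0 hH1 (s := n) (by linarith) (by linarith)
  simp only [Real.rpow_natCast] at h
  rw [h, volConst_eq hH0 hH1, show (n : ℝ) + 2 - 2 * H = n + (2 - 2 * H) by ring,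
    show (n : ℝ) + 3 / 2 - H = n + (3 / 2 - H) by ring]
  have hg := Gamma_add_nat_div (show 0 < 2 - 2 * H by linarith) n (show 0 < 3 / 2 - H by linarith)
  have h2 := (Real.Gamma_pos_of_pos (show 0 < 2 - 2 * H by linarith)).ne'
  have h3 := (Real.Gamma_pos_of_pos (show 0 < H + 1 / 2 by linarith)).ne'
  have h4 := (Real.Gamma_pos_of_pos (show 0 < n + (3 / 2 - H) by linarith)).ne'
  have h5 : (n : ℝ) + 1 ≠ 0 := by positivity
  generalize Real.Gamma (n + (2 - 2 * H)) = g1 at *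
  generalize Real.Gamma (n + (3 / 2 - H)) = g2 at *
  generalize Real.Gamma (H + 1 / 2) = g3 at *
  generalize Real.Gamma (2 - 2 * H) = g4 at *
  generalize Real.Gamma (3 / 2 - H) = g5 at *
  generalize pochRatio (2 - 2 * H) (3 / 2 - H) n = p at *
  field_simp
  linear_combination hg

lemma volConst_mul_moment_rpow (hH0 : 0 < H) (hH1 : H < 1) :
    H * (3 / 2 - H) * betaTail H 0 *
      (volConst H * ∫ x in (0 : ℝ)..1, profile H x * x ^ (2 * H - 1)) = 1 / 2 := by
  rw [integral_profile_mul hH0 hH1 (by linarith) (by linarith), volConst_eq hH0 hH1,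
    betaTail_zero hH0 hH1, show 2 * H - 1 + 2 - 2 * H = 1 by ring, Real.Gamma_one,
    show 2 * H - 1 + 3 / 2 - H = H + 1 / 2 by ring, show 5 / 2 - H = (3 / 2 - H) + 1 by ring,
    Real.Gamma_add_one (show 3 / 2 - H ≠ 0 by linarith)]
  have h1 : 3 / 2 - H ≠ 0 := by linarith
  have h2 := (Real.Gamma_pos_of_pos (show 0 < 2 - 2 * H by linarith)).ne'
  have h3 := (Real.Gamma_pos_of_pos (show 0 < H + 1 / 2 by linarith)).ne'
  have h4 := (Real.Gamma_pos_of_pos (show 0 < 3 / 2 - H by linarith)).ne'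
  generalize Real.Gamma (3 / 2 - H) = g2 at *
  generalize Real.Gamma (H + 1 / 2) = g3 at *
  generalize Real.Gamma (2 - 2 * H) = g4 at *
  generalize 3 / 2 - H = y at *
  rw [show 2 * H - 1 + 1 = 2 * H by ring]
  field_simp

end FBM

end


/-! ### Correlations of the profile with its dilates. -/

noncomputable section

namespace FBM

variable {H : ℝ}

/-- The correlation integral of two kernels at times with ratio `r`. -/
def profileCorr (H r : ℝ) : ℝ :=
  ∫ x in (0 : ℝ)..1, profile H x * ((r * x) ^ (2 * H - 1) * profile H (r * x))

lemma intervalIntegrable_profile (hH0 : 0 < H) (hH1 : H < 1) :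
    IntervalIntegrable (profile H) volume 0 1 := by
  simpa using intervalIntegrable_profile_mul hH0 hH1 (s := 0) (by linarith) (by linarith)

/-- The two Pochhammer quotients are reciprocal, so only the binomial coefficients of `(1-r)^(2H)`
survive. -/
lemma profileCoeff_mul_moment (hH0 : 0 < H) (hH1 : H < 1) (n : ℕ) :
    profileCoeff H n * (volConst H * ∫ x in (0 : ℝ)..1, profile H x * x ^ n) =
      -(1 / 2) * pochRatio (-(2 * H)) 1 (n + 1) := by
  have h := (pochRatio_pos (x := 3 / 2 - H) (y := 2 - 2 * H) (by linarith) (by linarith) n).ne'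
  have h5 : (n : ℝ) + 1 ≠ 0 := by positivity
  rw [volConst_mul_moment hH0 hH1, profileCoeff, ← pochRatio_inv (3 / 2 - H)]
  generalize pochRatio (3 / 2 - H) (2 - 2 * H) n = p at *
  field_simp

/-- The factor at `r x` is expanded and integrated termwise against the profile; the absolutely
convergent series at `r < 1` is the majorant for all `x`. The regular part sums to `(1 -
(1-r)^(2H))/2`, and the separate power contributes `r^(2H)/2`. -/
lemma profileCorr_of_lt_one (hH0 : 0 < H) (hH1 : H < 1) {r : ℝ} (hr : r ∈ Ioo (0 : ℝ) 1) :
    r * (volConst H * profileCorr H r) = (1 + r ^ (2 * H) - (1 - r) ^ (2 * H)) / 2 := by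
  have hr0 : 0 < r := hr.1
  set A : ℝ := H * (3 / 2 - H) * betaTail H 0 with hA
  have hmem : ∀ x ∈ Ioo (0 : ℝ) 1, r * x ∈ Ioo (0 : ℝ) 1 := fun x hx =>
    ⟨mul_pos hr0 hx.1, by nlinarith [hx.1, hx.2, hr.2]⟩
  have hsum := (hasSum_profileCoeff hH0 hH1 hr).summable.abs
  have h1 := hasSum_integral_smul zero_le_one (intervalIntegrable_profile hH0 hH1)
    (g := fun n x => profileCoeff H n * (r * x) ^ n)
    (G := fun x => (r * x) ^ (2 * H - 1) * profile H (r * x) - A * (r * x) ^ (2 * H - 1))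
    (fun n => by fun_prop) hsum
    (fun n x hx => by
      have := hx.1.le
      have h1 : r * x ≤ r := by nlinarith [hx.2]
      rw [norm_mul, abs_mul, norm_pow, abs_pow, Real.norm_eq_abs, Real.norm_eq_abs,
        abs_of_pos (hmem x hx).1, abs_of_pos hr0]
      gcongr)
    (fun x hx => hasSum_profileCoeff hH0 hH1 (hmem x hx))
  have e1 : ∀ n : ℕ, ∫ x in (0 : ℝ)..1, profile H x • (profileCoeff H n * (r * x) ^ n) =
      profileCoeff H n * r ^ n * ∫ x in (0 : ℝ)..1, profile H x * x ^ n := fun n => by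
    rw [← intervalIntegral.integral_const_mul]
    congr 1; ext x
    rw [smul_eq_mul, mul_pow]; ring
  have i2 := (intervalIntegrable_profile_mul hH0 hH1 (s := 2 * H - 1) (by linarith)
    (by linarith)).const_mul (A * r ^ (2 * H - 1))
  have e3 : ∀ x ∈ Ioo (0 : ℝ) 1, profile H x • ((r * x) ^ (2 * H - 1) * profile H (r * x) -
      A * (r * x) ^ (2 * H - 1)) = profile H x * ((r * x) ^ (2 * H - 1) * profile H (r * x)) -
        A * r ^ (2 * H - 1) * (profile H x * x ^ (2 * H - 1)) := fun x hx => by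
    rw [smul_eq_mul, Real.mul_rpow hr0.le hx.1.le]; ring
  have h2 := hasSum_pochRatio_one (-(2 * H)) (x := r) (by rw [abs_of_pos hr0]; exact hr.2)
  rw [neg_neg] at h2
  have h3 := ((hasSum_nat_add_iff' 1).2 h2).mul_left (-(1 / 2))
  have h4 := (h1.mul_left (r * volConst H)).unique
    (h3.congr_terms (fun n => by
      rw [e1]
      have := profileCoeff_mul_moment hH0 hH1 n
      rw [pow_succ]
      linear_combination (r ^ n * r) * this) rfl)
  have i1 : IntervalIntegrable (fun x => profile H x * ((r * x) ^ (2 * H - 1) * profile H (r * x)))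
      volume 0 1 := by
    -- The correlation integrand is integrable because its regular part is an integrable function
    -- times one bounded by `S`; this justifies splitting the integral.
    have hc : ContinuousOn (fun x => r ^ (2 * H - 1) * profile H (r * x)) (Ioo 0 1) :=
      continuousOn_const.mul ((profile_continuousOn hH0 hH1).comp (by fun_prop) hmem)
    obtain ⟨S, hS⟩ : ∃ S, ∀ x ∈ Ioo (0 : ℝ) 1, |(r * x) ^ (2 * H - 1) * profile H (r * x) -
        A * (r * x) ^ (2 * H - 1)| ≤ S := by
      refine ⟨∑' n, |profileCoeff H n * r ^ n|, fun x hx => ?_⟩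
      have hs := hasSum_profileCoeff hH0 hH1 (hmem x hx)
      rw [← hs.tsum_eq, ← Real.norm_eq_abs]
      refine (norm_tsum_le_tsum_norm hs.summable.norm).trans
        (hs.summable.norm.tsum_le_tsum (fun n => ?_) hsum)
      have := hx.1.le
      have h1 : r * x ≤ r := by nlinarith [hx.2]
      rw [norm_mul, abs_mul, norm_pow, abs_pow, Real.norm_eq_abs, Real.norm_eq_abs,
        abs_of_pos (hmem x hx).1, abs_of_pos hr0]
      gcongr
    have i3 : IntervalIntegrable (fun x => profile H x * ((r * x) ^ (2 * H - 1) * profile H (r * x) -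
        A * (r * x) ^ (2 * H - 1))) volume 0 1 := by
      have hp := intervalIntegrable_profile hH0 hH1
      rw [intervalIntegrable_iff_integrableOn_Ioo_of_le zero_le_one] at hp ⊢
      refine Integrable.mul_bdd (c := S) hp ?_ ?_
      · refine ContinuousOn.aestronglyMeasurable ?_ measurableSet_Ioo
        have h1 : ContinuousOn (fun x : ℝ => (r * x) ^ (2 * H - 1)) (Ioo 0 1) :=
          ContinuousOn.rpow_const (by fun_prop) fun x hx => Or.inl (hmem x hx).1.ne'
        exact (h1.mul ((profile_continuousOn hH0 hH1).comp (by fun_prop) hmem)).sub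
          (continuousOn_const.mul h1)
      · exact (ae_restrict_iff' measurableSet_Ioo).2 (Filter.Eventually.of_forall hS)
    refine intervalIntegrable_congr_Ioo zero_le_one (fun x hx => ?_) (i3.add i2)
    rw [Real.mul_rpow hr0.le hx.1.le]; ring
  rw [integral_congr_Ioo zero_le_one e3, intervalIntegral.integral_sub i1 i2,
    intervalIntegral.integral_const_mul] at h4
  have h5 := volConst_mul_moment_rpow hH0 hH1
  rw [← hA] at h5
  have h6 : r * r ^ (2 * H - 1) = r ^ (2 * H) := by
    rw [mul_comm, ← Real.rpow_add_one hr0.ne']; ring_nf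
  simp only [Finset.range_one, Finset.sum_singleton, pochRatio_zero, pow_zero, mul_one] at h4
  rw [profileCorr]
  linear_combination h4 + (r * r ^ (2 * H - 1)) * h5 + h6 / 2

/-- A power is monotone or antitone according to the sign of the exponent; the sum of the endpoint
values bounds it in both cases, so `H < 1/2` and `H > 1/2` need no separate treatment. -/
lemma rpow_le_add_rpow {a y b p : ℝ} (ha : 0 < a) (hay : a ≤ y) (hyb : y ≤ b) :
    y ^ p ≤ a ^ p + b ^ p := by
  have hy := ha.trans_le hay
  rcases le_total 0 p with hp | hp
  · have := Real.rpow_le_rpow hy.le hyb hp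
    have : 0 ≤ a ^ p := by positivity
    linarith
  · have := Real.rpow_le_rpow_of_nonpos ha hay hp
    have : 0 ≤ b ^ p := Real.rpow_nonneg (hy.le.trans hyb) _
    linarith

/-- An upper bound for the kernels `x_t`, up to a constant. -/
def profileBound (H x : ℝ) : ℝ := 1 + (1 - x) ^ (H - 1 / 2) + x ^ (2 * H - 1)

/-- The bound is uniform in `r`, which provides the majorant for the limit `r → 1`. -/
lemma exists_profile_le (hH0 : 0 < H) (hH1 : H < 1) : ∃ D : ℝ, 0 ≤ D ∧
    ∀ x ∈ Ioo (0 : ℝ) 1, ∀ r ∈ Icc (1 / 2 : ℝ) 1,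
      r * x ∈ Ioo (0 : ℝ) 1 ∧ (r * x) ^ (2 * H - 1) * profile H (r * x) ≤ D * profileBound H x := by
  have hB0 : 0 ≤ betaTail H 0 := betaTail_nonneg (by simp)
  have ha : 0 ≤ 3 / 2 - H := by linarith
  have h2 : (0 : ℝ) ≤ (1 / 2 : ℝ) ^ (2 * H - 1) := by positivity
  refine ⟨H * (2 + (3 / 2 - H) * betaTail H 0 * ((1 / 2) ^ (2 * H - 1) + 1)), by positivity,
    fun x hx r hr => ?_⟩
  have hx0 : 0 < x := hx.1
  have hr0 : 0 < r := by linarith [hr.1]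
  have hrx : r * x ≤ x := by nlinarith [hr.2]
  have hrx' : r * x ∈ Ioo (0 : ℝ) 1 := ⟨by positivity, by linarith [hx.2]⟩
  refine ⟨hrx', ?_⟩
  have b1 : (1 - r * x) ^ (H - 1 / 2) ≤ (1 - x) ^ (H - 1 / 2) + 1 := by
    have := rpow_le_add_rpow (a := 1 - x) (y := 1 - r * x) (b := 1) (p := H - 1 / 2)
      (by linarith [hx.2]) (by linarith) (by linarith [hrx'.1])
    rwa [Real.one_rpow] at this
  have b2 : (r * x) ^ (2 * H - 1) ≤ ((1 / 2) ^ (2 * H - 1) + 1) * x ^ (2 * H - 1) := by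
    have := rpow_le_add_rpow (a := 1 / 2 * x) (y := r * x) (b := x) (p := 2 * H - 1)
      (by positivity) (by nlinarith [hr.1]) hrx
    rw [Real.mul_rpow (x := 1 / 2) (by norm_num) hx0.le] at this
    linarith
  have b3 := betaTail_le hH0 hH1 ⟨hrx'.1.le, hrx'.2.le⟩
  have b4 := betaTail_nonneg (H := H) ⟨hrx'.1.le, hrx'.2.le⟩
  have a1 : (r * x) ^ (2 * H - 1) * (r * x) ^ (1 - 2 * H) = 1 := by
    rw [← Real.rpow_add hrx'.1]; norm_num
  have p1 : 0 ≤ (1 - x) ^ (H - 1 / 2) := Real.rpow_nonneg (by linarith [hx.2]) _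
  have p2 : 0 ≤ x ^ (2 * H - 1) := by positivity
  have p3 : 0 ≤ (1 - r * x) ^ (H - 1 / 2) := Real.rpow_nonneg (by linarith [hrx'.2]) _
  have p4 : 0 ≤ (r * x) ^ (2 * H - 1) := Real.rpow_nonneg hrx'.1.le _
  calc (r * x) ^ (2 * H - 1) * profile H (r * x)
      = H * ((1 + r * x) * (1 - r * x) ^ (H - 1 / 2) +
          (3 / 2 - H) * (betaTail H (r * x) * (r * x) ^ (2 * H - 1))) := by
        rw [profile]
        linear_combination (H * (1 + r * x) * (1 - r * x) ^ (H - 1 / 2)) * a1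
    _ ≤ H * (2 * ((1 - x) ^ (H - 1 / 2) + 1) + (3 / 2 - H) * (betaTail H 0 *
          (((1 / 2) ^ (2 * H - 1) + 1) * x ^ (2 * H - 1)))) := by
        gcongr
        linarith [hrx'.2]
    _ ≤ _ := by
        rw [profileBound]
        have q1 : 0 ≤ (3 / 2 - H) * betaTail H 0 * ((1 / 2) ^ (2 * H - 1) + 1) := by positivity
        have q2 := mul_nonneg q1 p1
        rw [mul_assoc H]
        refine mul_le_mul_of_nonneg_left ?_ hH0.le
        nlinarith

/-- By `(a+b+c)² ≤ 3(a²+b²+c²)` the exponents that occur are `1-2H` and `2H-1`, and both exceed `-1`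
for `0 < H < 1`. -/
lemma intervalIntegrable_profileBound (hH0 : 0 < H) (hH1 : H < 1) :
    IntervalIntegrable (fun x => x ^ (1 - 2 * H) * profileBound H x ^ 2) volume 0 1 := by
  have i1 := intervalIntegrable_beta (p := 1 - 2 * H) (q := 0) (by linarith) (by linarith)
  have i2 := intervalIntegrable_beta (p := 1 - 2 * H) (q := 2 * (H - 1 / 2)) (by linarith) (by linarith)
  have i3 := intervalIntegrable_beta (p := 2 * H - 1) (q := 0) (by linarith) (by linarith)
  have i4 := ((i1.add i2).add i3).const_mul 3
  rw [intervalIntegrable_iff_integrableOn_Ioo_of_le zero_le_one] at i4 ⊢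
  refine Integrable.mono' i4 ?_ ?_
  · refine ContinuousOn.aestronglyMeasurable ?_ measurableSet_Ioo
    unfold profileBound
    have c1 : ∀ p : ℝ, ContinuousOn (fun x : ℝ => x ^ p) (Ioo 0 1) := fun p =>
      continuousOn_id.rpow_const fun x hx => Or.inl hx.1.ne'
    have c2 : ∀ p : ℝ, ContinuousOn (fun x : ℝ => (1 - x) ^ p) (Ioo 0 1) := fun p =>
      ContinuousOn.rpow_const (by fun_prop) fun x hx => Or.inl (by linarith [hx.2])
    exact (c1 _).mul (((continuousOn_const.add (c2 _)).add (c1 _)).pow 2)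
  · refine (ae_restrict_iff' measurableSet_Ioo).2 (Filter.Eventually.of_forall fun x hx => ?_)
    have hx0 := hx.1
    have hx1 : 0 < 1 - x := by linarith [hx.2]
    have p1 : 0 ≤ x ^ (1 - 2 * H) := by positivity
    have e1 : (1 - x) ^ (2 * (H - 1 / 2)) = ((1 - x) ^ (H - 1 / 2)) ^ 2 := by
      rw [← Real.rpow_natCast, ← Real.rpow_mul hx1.le]; congr 1; push_cast; ring
    have e2 : x ^ (2 * H - 1) = x ^ (1 - 2 * H) * (x ^ (2 * H - 1)) ^ 2 := by
      rw [← Real.rpow_natCast, ← Real.rpow_mul hx0.le, ← Real.rpow_add hx0]; congr 1; push_cast; ring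
    rw [Real.norm_of_nonneg (by positivity), Real.rpow_zero, mul_one, mul_one, e1, e2, profileBound]
    nth_rewrite 1 [show x ^ (1 - 2 * H) * (x ^ (2 * H - 1)) ^ 2 = x ^ (2 * H - 1) from e2.symm]
    generalize x ^ (1 - 2 * H) = w at *
    generalize x ^ (2 * H - 1) = v at *
    generalize (1 - x) ^ (H - 1 / 2) = y at *
    -- This is `3(1+y²+v²) - (1+y+v)²` written as a sum of squares.
    have : 0 ≤ w * ((1 - y) ^ 2 + (1 - v) ^ 2 + (y - v) ^ 2) := by positivity
    nlinarith

lemma profile_corr_bound (hH0 : 0 < H) (hH1 : H < 1) : ∃ D : ℝ,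
    ∀ x ∈ Ioo (0 : ℝ) 1, ∀ r ∈ Icc (1 / 2 : ℝ) 1,
      |profile H x * ((r * x) ^ (2 * H - 1) * profile H (r * x))| ≤
        D * (x ^ (1 - 2 * H) * profileBound H x ^ 2) := by
  obtain ⟨D, hD, h⟩ := exists_profile_le hH0 hH1
  refine ⟨D * D, fun x hx r hr => ?_⟩
  obtain ⟨h1, h2⟩ := h x hx r hr
  obtain ⟨-, h3⟩ := h x hx 1 (by norm_num)
  rw [one_mul] at h3
  have hx0 := hx.1
  have n1 := profile_nonneg hH0 hH1 ⟨hx.1.le, hx.2.le⟩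
  have n2 := profile_nonneg hH0 hH1 ⟨h1.1.le, h1.2.le⟩
  have n3 : 0 ≤ (r * x) ^ (2 * H - 1) := Real.rpow_nonneg h1.1.le _
  have n4 : 0 ≤ profileBound H x := by
    have : 0 ≤ 1 - x := by linarith [hx.2]
    unfold profileBound; positivity
  have a1 : x ^ (1 - 2 * H) * x ^ (2 * H - 1) = 1 := by
    rw [← Real.rpow_add hx0]; norm_num
  have h4 : profile H x ≤ x ^ (1 - 2 * H) * (D * profileBound H x) := by
    calc profile H x = x ^ (1 - 2 * H) * (x ^ (2 * H - 1) * profile H x) := by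
          rw [← mul_assoc, a1, one_mul]
      _ ≤ _ := by gcongr
  rw [abs_of_nonneg (by positivity)]
  calc _ ≤ (x ^ (1 - 2 * H) * (D * profileBound H x)) * (D * profileBound H x) := by gcongr
    _ = _ := by ring

lemma intervalIntegrable_profile_sq (hH0 : 0 < H) (hH1 : H < 1) :
    IntervalIntegrable (fun x => profile H x * (x ^ (2 * H - 1) * profile H x)) volume 0 1 := by
  obtain ⟨D, hD⟩ := profile_corr_bound hH0 hH1
  have i4 := (intervalIntegrable_profileBound hH0 hH1).const_mul D
  rw [intervalIntegrable_iff_integrableOn_Ioo_of_le zero_le_one] at i4 ⊢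
  refine Integrable.mono' i4 ?_ ?_
  · refine ContinuousOn.aestronglyMeasurable ?_ measurableSet_Ioo
    have c1 : ContinuousOn (fun x : ℝ => x ^ (2 * H - 1)) (Ioo 0 1) :=
      continuousOn_id.rpow_const fun x hx => Or.inl hx.1.ne'
    have c2 := profile_continuousOn hH0 hH1
    exact c2.mul (c1.mul c2)
  · refine (ae_restrict_iff' measurableSet_Ioo).2 (Filter.Eventually.of_forall fun x hx => ?_)
    have := hD x hx 1 (by norm_num)
    rwa [one_mul] at this

/-- The termwise argument lacks its majorant at `r = 1`, so the formula for `r < 1` is continued by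
a left limit under dominated convergence. -/
lemma volConst_mul_profileCorr_one (hH0 : 0 < H) (hH1 : H < 1) :
    volConst H * profileCorr H 1 = 1 := by
  obtain ⟨D, hD⟩ := profile_corr_bound hH0 hH1
  have hIoo : ∀ᶠ r : ℝ in nhdsWithin 1 (Iio 1), r ∈ Ioo (1 / 2 : ℝ) 1 :=
    Ioo_mem_nhdsLT (by norm_num)
  have hmem : ∀ x ∈ Ioo (0 : ℝ) 1, ∀ r ∈ Ioo (1 / 2 : ℝ) 1, r * x ∈ Ioo (0 : ℝ) 1 :=
    fun x hx r hr => ⟨mul_pos (by linarith [hr.1]) hx.1, by nlinarith [hx.1, hx.2, hr.2]⟩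
  have c2 := profile_continuousOn hH0 hH1
  have hT : Filter.Tendsto (profileCorr H) (nhdsWithin 1 (Iio 1)) (nhds (profileCorr H 1)) := by
    refine intervalIntegral.tendsto_integral_filter_of_dominated_convergence
      (fun x => D * (x ^ (1 - 2 * H) * profileBound H x ^ 2)) ?_ ?_
      ((intervalIntegrable_profileBound hH0 hH1).const_mul D) ?_
    · filter_upwards [hIoo] with r hr
      rw [uIoc_of_le zero_le_one, ← restrict_Ioo_eq_restrict_Ioc]
      refine ContinuousOn.aestronglyMeasurable ?_ measurableSet_Ioo
      have c1 : ContinuousOn (fun x : ℝ => (r * x) ^ (2 * H - 1)) (Ioo 0 1) :=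
        ContinuousOn.rpow_const (by fun_prop) fun x hx => Or.inl (hmem x hx r hr).1.ne'
      exact c2.mul (c1.mul (c2.comp (by fun_prop) fun x hx => hmem x hx r hr))
    · filter_upwards [hIoo] with r hr
      have hne : ∀ᵐ x : ℝ, x ≠ 1 := by simp [ae_iff]
      filter_upwards [hne] with x hx1 hx
      rw [uIoc_of_le zero_le_one] at hx
      exact hD x ⟨hx.1, lt_of_le_of_ne hx.2 hx1⟩ r ⟨hr.1.le, hr.2.le⟩
    · have hne : ∀ᵐ x : ℝ, x ≠ 1 := by simp [ae_iff]
      filter_upwards [hne] with x hx1 hx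
      rw [uIoc_of_le zero_le_one] at hx
      have hx' : x ∈ Ioo (0 : ℝ) 1 := ⟨hx.1, lt_of_le_of_ne hx.2 hx1⟩
      have c3 : ContinuousAt (profile H) (1 * x) := by
        rw [one_mul]; exact c2.continuousAt (Ioo_mem_nhds hx'.1 hx'.2)
      have c4 : ContinuousAt (fun r : ℝ => r * x) 1 := by fun_prop
      have c5 : ContinuousAt (fun r : ℝ => profile H x * ((r * x) ^ (2 * H - 1) * profile H (r * x))) 1 :=
        continuousAt_const.mul ((c4.rpow_const (Or.inl (by rw [one_mul]; exact hx'.1.ne'))).mul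
          (ContinuousAt.comp (f := fun r : ℝ => r * x) c3 c4))
      exact c5.mono_left nhdsWithin_le_nhds
  have hT1 : Filter.Tendsto (fun r : ℝ => r * (volConst H * profileCorr H r)) (nhdsWithin 1 (Iio 1))
      (nhds (1 * (volConst H * profileCorr H 1))) :=
    (Filter.tendsto_id.mono_left nhdsWithin_le_nhds).mul (hT.const_mul _)
  have hT2 : Filter.Tendsto (fun r : ℝ => (1 + r ^ (2 * H) - (1 - r) ^ (2 * H)) / 2)
      (nhdsWithin 1 (Iio 1)) (nhds ((1 + 1 ^ (2 * H) - (1 - 1) ^ (2 * H)) / 2)) := by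
    refine Filter.Tendsto.mono_left ?_ nhdsWithin_le_nhds
    have : ContinuousAt (fun r : ℝ => (1 + r ^ (2 * H) - (1 - r) ^ (2 * H)) / 2) 1 := by
      have h2 : 0 ≤ 2 * H := by linarith
      have d1 : ContinuousAt (fun r : ℝ => r ^ (2 * H)) 1 :=
        continuousAt_id.rpow_const (Or.inr h2)
      have d2 : ContinuousAt (fun r : ℝ => (1 - r) ^ (2 * H)) 1 :=
        ContinuousAt.rpow_const (by fun_prop) (Or.inr h2)
      exact ((continuousAt_const.add d1).sub d2).div_const _
    exact this
  have hEq := tendsto_nhds_unique (hT1.congr' (by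
    filter_upwards [hIoo] with r hr
    exact profileCorr_of_lt_one hH0 hH1 ⟨by linarith [hr.1], hr.2⟩)) hT2
  have h0 : (2 : ℝ) * H ≠ 0 := by linarith
  rw [one_mul] at hEq
  rw [hEq]
  simp [Real.zero_rpow h0]

lemma profileCorr_eq (hH0 : 0 < H) (hH1 : H < 1) {r : ℝ} (hr : r ∈ Ioc (0 : ℝ) 1) :
    r * (volConst H * profileCorr H r) = (1 + r ^ (2 * H) - (1 - r) ^ (2 * H)) / 2 := by
  rcases hr.2.eq_or_lt with rfl | h
  · have h0 : (2 : ℝ) * H ≠ 0 := by linarith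
    rw [volConst_mul_profileCorr_one hH0 hH1]
    simp [Real.zero_rpow h0]
  · exact profileCorr_of_lt_one hH0 hH1 ⟨hr.1, h⟩

end FBM

end


/-! ### Gram matrix and Fourier transform of the kernels in `L²(V)`. -/

noncomputable section

namespace FBM

variable {H T t : ℝ}

lemma measurable_volDensity (H : ℝ) :
    Measurable fun u : ℝ => ENNReal.ofReal (dSq H * (2 - 2 * H) * u ^ (1 - 2 * H)) := by
  fun_prop

lemma varMeasure_absolutelyContinuous (H T : ℝ) : varMeasure H T ≪ volume :=
  (withDensity_absolutelyContinuous _ _).trans Measure.absolutelyContinuous_restrict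

lemma toReal_volDensity (hH0 : 0 < H) (hH1 : H < 1) {u : ℝ} (hu : 0 < u) :
    (ENNReal.ofReal (dSq H * (2 - 2 * H) * u ^ (1 - 2 * H))).toReal =
      volConst H * u ^ (1 - 2 * H) := by
  have := volConst_pos hH0 hH1
  rw [← volConst, ENNReal.toReal_ofReal (by positivity)]

lemma volDensity_smul_eq_indicator (hH0 : 0 < H) (hH1 : H < 1) {F : ℝ → ℂ}
    (hF : ∀ u, u ∉ Ioo 0 t → F u = 0) :
    (fun u => (ENNReal.ofReal (dSq H * (2 - 2 * H) * u ^ (1 - 2 * H))).toReal • F u) =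
      (Ioo 0 t).indicator fun u => (volConst H * u ^ (1 - 2 * H)) • F u := by
  ext u
  by_cases hu : u ∈ Ioo 0 t
  · rw [indicator_of_mem hu, toReal_volDensity hH0 hH1 hu.1]
  · rw [indicator_of_notMem hu, hF u hu, smul_zero]

lemma integral_varMeasure (hH0 : 0 < H) (hH1 : H < 1) (ht : 0 ≤ t) (htT : t ≤ T) {F : ℝ → ℂ}
    (hF : ∀ u, u ∉ Ioo 0 t → F u = 0) :
    ∫ u, F u ∂(varMeasure H T) = ∫ u in (0 : ℝ)..t, (volConst H * u ^ (1 - 2 * H)) • F u := by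
  rw [varMeasure, integral_withDensity_eq_integral_toReal_smul (measurable_volDensity H) (by simp),
    volDensity_smul_eq_indicator hH0 hH1 hF, setIntegral_indicator measurableSet_Ioo,
    inter_eq_right.2 (Ioo_subset_Icc_self.trans (Icc_subset_Icc_right htT)),
    intervalIntegral.integral_of_le ht, integral_Ioc_eq_integral_Ioo]

lemma integrable_varMeasure (hH0 : 0 < H) (hH1 : H < 1) (ht : 0 ≤ t) {F : ℝ → ℂ}
    (hF : ∀ u, u ∉ Ioo 0 t → F u = 0)
    (hi : IntervalIntegrable (fun u => (volConst H * u ^ (1 - 2 * H)) • F u) volume 0 t) :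
    Integrable F (varMeasure H T) := by
  rw [varMeasure, integrable_withDensity_iff_integrable_smul' (measurable_volDensity H) (by simp),
    volDensity_smul_eq_indicator hH0 hH1 hF]
  rw [intervalIntegrable_iff_integrableOn_Ioo_of_le ht] at hi
  exact ((integrable_indicator_iff measurableSet_Ioo).2 hi).mono_measure Measure.restrict_le_self

lemma div_mem_Ioo (ht : 0 < t) {u : ℝ} (hu : u ∈ Ioo 0 t) : u / t ∈ Ioo (0 : ℝ) 1 :=
  ⟨div_pos hu.1 ht, (div_lt_one ht).2 hu.2⟩

lemma volDensity_smul_movAvgKernel (hH0 : 0 < H) (hH1 : H < 1) (ht : 0 < t) (g : ℝ → ℂ) {u : ℝ}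
    (hu : u ∈ Ioo 0 t) : (volConst H * u ^ (1 - 2 * H)) • (movAvgKernel H t u * g u) =
      volConst H • profile H (u / t) • g (t * (u / t)) := by
  have a1 : u ^ (1 - 2 * H) * u ^ (2 * H - 1) = 1 := by
    rw [← Real.rpow_add hu.1]; norm_num
  rw [movAvgKernel_eq hH0 hH1 hu.1 hu.2, mul_div_cancel₀ _ ht.ne', ← Complex.real_smul, smul_smul,
    smul_smul]
  congr 1
  linear_combination (volConst H * profile H (u / t)) * a1

/-- The powers of `u` cancel and `u = t x` rescales to the unit interval. Taking for `g` another
kernel gives the covariance; taking `φ(· l)` gives the transform. -/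
lemma integral_movAvgKernel_mul (hH0 : 0 < H) (hH1 : H < 1) (ht : 0 < t) (htT : t ≤ T) (g : ℝ → ℂ) :
    ∫ u, movAvgKernel H t u * g u ∂(varMeasure H T) =
      (t * volConst H) • ∫ x in (0 : ℝ)..1, profile H x • g (t * x) := by
  rw [integral_varMeasure hH0 hH1 ht.le htT (F := fun u => movAvgKernel H t u * g u)
      (fun u hu => by simp only [movAvgKernel_eq_zero hu, zero_mul]),
    integral_congr_Ioo ht.le fun u hu => volDensity_smul_movAvgKernel hH0 hH1 ht g hu,
    intervalIntegral.integral_comp_div (fun x => volConst H • profile H x • g (t * x)) ht.ne',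
    zero_div, div_self ht.ne', intervalIntegral.integral_smul, smul_smul]

lemma integrable_movAvgKernel_mul (hH0 : 0 < H) (hH1 : H < 1) (ht : 0 < t) {g : ℝ → ℂ}
    (hi : IntervalIntegrable (fun x => profile H x • g (t * x)) volume 0 1) :
    Integrable (fun u => movAvgKernel H t u * g u) (varMeasure H T) := by
  refine integrable_varMeasure hH0 hH1 ht.le (fun u hu => by rw [movAvgKernel_eq_zero hu, zero_mul])
    (intervalIntegrable_congr_Ioo ht.le
      (fun u hu => volDensity_smul_movAvgKernel hH0 hH1 ht g hu) ?_)
  have := (hi.smul (volConst H)).comp_mul_right (c := t⁻¹)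
  simpa [div_eq_mul_inv] using this

lemma aestronglyMeasurable_movAvgKernel (hH0 : 0 < H) (hH1 : H < 1) (t : ℝ) :
    AEStronglyMeasurable (movAvgKernel H t) (varMeasure H T) := by
  refine AEStronglyMeasurable.mono_ac (varMeasure_absolutelyContinuous H T) ?_
  have e : movAvgKernel H t = (Ioo 0 t).indicator
      fun u => ((u ^ (2 * H - 1) * profile H (u / t) : ℝ) : ℂ) := by
    ext u
    by_cases hu : u ∈ Ioo 0 t
    · rw [indicator_of_mem hu, movAvgKernel_eq hH0 hH1 hu.1 hu.2]
    · rw [indicator_of_notMem hu, movAvgKernel_eq_zero hu]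
  rw [e, aestronglyMeasurable_indicator_iff measurableSet_Ioo]
  refine ContinuousOn.aestronglyMeasurable ?_ measurableSet_Ioo
  refine Complex.continuous_ofReal.comp_continuousOn (ContinuousOn.mul ?_ ?_)
  · exact continuousOn_id.rpow_const fun x hx => Or.inl hx.1.ne'
  · exact (profile_continuousOn hH0 hH1).comp (by fun_prop)
      fun u hu => div_mem_Ioo (hu.1.trans hu.2) hu

lemma movAvgKernel_scaled (hH0 : 0 < H) (hH1 : H < 1) {s : ℝ} (ht : 0 < t) (hts : t ≤ s) {x : ℝ}
    (hx : x ∈ Ioo (0 : ℝ) 1) : movAvgKernel H s (t * x) =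
      ((s ^ (2 * H - 1) * ((t / s * x) ^ (2 * H - 1) * profile H (t / s * x)) : ℝ) : ℂ) := by
  have hs : 0 < s := ht.trans_le hts
  have hx0 := hx.1
  rw [movAvgKernel_eq hH0 hH1 (by positivity) (by nlinarith [hx.2]),
    show t * x / s = t / s * x by ring, ← mul_assoc, ← Real.mul_rpow hs.le (by positivity),
    show s * (t / s * x) = t * x by field_simp]

/-- The covariance of fractional Brownian motion, as a Gram matrix of the kernels `x_t`. -/
lemma integral_movAvgKernel_mul_movAvgKernel (hH0 : 0 < H) (hH1 : H < 1) {s : ℝ} (ht : 0 ≤ t)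
    (hts : t ≤ s) (hsT : s ≤ T) :
    ∫ u, movAvgKernel H t u * movAvgKernel H s u ∂(varMeasure H T) =
      (((s ^ (2 * H) + t ^ (2 * H) - (s - t) ^ (2 * H)) / 2 : ℝ) : ℂ) := by
  have h2H : 2 * H ≠ 0 := by linarith
  rcases ht.eq_or_lt with rfl | ht
  · simp [movAvgKernel, Real.zero_rpow h2H]
  have hs : 0 < s := ht.trans_le hts
  rw [integral_movAvgKernel_mul hH0 hH1 ht (hts.trans hsT)]
  have e : ∀ x ∈ Ioo (0 : ℝ) 1, profile H x • movAvgKernel H s (t * x) =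
      ((s ^ (2 * H - 1) * (profile H x * ((t / s * x) ^ (2 * H - 1) * profile H (t / s * x))) : ℝ) : ℂ) :=
    fun x hx => by
      rw [movAvgKernel_scaled hH0 hH1 ht hts hx, Complex.real_smul, ← Complex.ofReal_mul]
      congr 1; ring
  rw [integral_congr_Ioo zero_le_one e, intervalIntegral.integral_ofReal,
    intervalIntegral.integral_const_mul, ← profileCorr, Complex.real_smul, ← Complex.ofReal_mul]
  congr 1
  have hr : t / s ∈ Ioc (0 : ℝ) 1 := ⟨by positivity, (div_le_one hs).2 hts⟩
  have h := profileCorr_eq hH0 hH1 hr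
  have e1 : s ^ (2 * H) * (t / s) ^ (2 * H) = t ^ (2 * H) := by
    rw [← Real.mul_rpow hs.le hr.1.le, mul_div_cancel₀ _ hs.ne']
  have e2 : s ^ (2 * H) * (1 - t / s) ^ (2 * H) = (s - t) ^ (2 * H) := by
    rw [← Real.mul_rpow hs.le (by linarith [hr.2])]
    congr 1; field_simp
  have e3 : s ^ (2 * H - 1) * s = s ^ (2 * H) := by
    rw [← Real.rpow_add_one hs.ne']; ring_nf
  rw [← e1, ← e2, ← e3]
  have e4 : t = s * (t / s) := by field_simp
  generalize t / s = r at *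
  rw [e4]
  linear_combination (s ^ (2 * H - 1) * s) * h

lemma memLp_movAvgKernel (hH0 : 0 < H) (hH1 : H < 1) (ht : 0 ≤ t) :
    MemLp (movAvgKernel H t) 2 (varMeasure H T) := by
  have hm := aestronglyMeasurable_movAvgKernel (T := T) hH0 hH1 t
  rw [memLp_two_iff_integrable_sq_norm hm]
  rcases ht.eq_or_lt with rfl | ht
  · simp [movAvgKernel]
  have h : Integrable (fun u => movAvgKernel H t u * movAvgKernel H t u) (varMeasure H T) := by
    refine integrable_movAvgKernel_mul hH0 hH1 ht (intervalIntegrable_congr_Ioo zero_le_one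
      (g := fun x => ((t ^ (2 * H - 1) *
        (profile H x * (x ^ (2 * H - 1) * profile H x)) : ℝ) : ℂ)) (fun x hx => ?_) ?_)
    · rw [movAvgKernel_scaled hH0 hH1 ht le_rfl hx, Complex.real_smul, ← Complex.ofReal_mul,
        div_self ht.ne', one_mul]
      congr 1; ring
    · have hi := (intervalIntegrable_profile_sq hH0 hH1).const_mul (t ^ (2 * H - 1))
      exact ⟨Integrable.ofReal hi.1, Integrable.ofReal hi.2⟩
  refine h.norm.congr (Filter.Eventually.of_forall fun u => ?_)
  simp only [norm_mul, sq]

lemma hasSum_exp_sub_one_div (t : ℝ) {z : ℂ} (hz : z ≠ 0) :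
    HasSum (fun n : ℕ => (t : ℂ) * ((Complex.I * (t * z)) ^ n / (n + 1).factorial))
      ((Complex.exp (Complex.I * z * t) - 1) / (Complex.I * z)) := by
  have hIz : Complex.I * z ≠ 0 := mul_ne_zero Complex.I_ne_zero hz
  have h : HasSum (fun n : ℕ => (Complex.I * z * t) ^ n / (n.factorial : ℂ))
      (Complex.exp (Complex.I * z * t)) := by
    rw [Complex.exp_eq_exp_ℂ]
    exact NormedSpace.expSeries_div_hasSum_exp _
  have h1 := ((hasSum_nat_add_iff' 1).2 h).div_const (Complex.I * z)
  refine h1.congr_terms (fun n => ?_) (by simp)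
  rw [pow_succ, show Complex.I * (t * z) = Complex.I * z * t by ring]
  field_simp

/-- The transform of `x_t` is `e_t`. -/
lemma kernelTransform_movAvgKernel (hH0 : 0 < H) (hH1 : H < 1) (ht : 0 ≤ t) (htT : t ≤ T) (l : ℝ) :
    kernelTransform H T (movAvgKernel H t) l = expFun t l := by
  rcases ht.eq_or_lt with rfl | ht
  · simp [kernelTransform, movAvgKernel, expFun]
  rw [kernelTransform, integral_movAvgKernel_mul hH0 hH1 ht htT]
  have hs := hasSum_integral_smul zero_le_one (intervalIntegrable_profile hH0 hH1)
    (g := fun n x => kernelSeries H n (((t * x : ℝ) : ℂ) * l))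
    (G := fun x => fourierKernel H (((t * x : ℝ) : ℂ) * l))
    (fun n => by unfold kernelSeries; fun_prop)
    (Real.summable_pow_div_factorial ((1 + (3 / 2 - H) / (2 - 2 * H)) * (t * |l|)))
    (fun n x hx => norm_kernelSeries_le hH1 n (by
      rw [norm_mul, Complex.norm_real, Complex.norm_real, Real.norm_eq_abs, Real.norm_eq_abs,
        abs_of_pos (mul_pos ht hx.1)]
      have : t * x ≤ t := by nlinarith [hx.2]
      gcongr))
    (fun x hx => by
      rw [fourierKernel_eq_tsum hH1]
      refine Summable.hasSum (Summable.of_norm_bounded (Real.summable_pow_div_factorial _)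
        fun n => norm_kernelSeries_le hH1 n le_rfl))
  have hs2 := hs.const_smul (t * volConst H)
  -- The moment of order `n` cancels the Pochhammer quotient of `φ` and leaves `1/(n+1)`, which
  -- raises `n!` to `(n+1)!`.
  have hterm : ∀ n : ℕ, (t : ℂ) * ((Complex.I * (t * l)) ^ n / (n + 1).factorial) =
      (t * volConst H) • ∫ x in (0 : ℝ)..1, profile H x • kernelSeries H n (((t * x : ℝ) : ℂ) * l) := by
    intro n
    have e : ∀ x : ℝ, profile H x • kernelSeries H n (((t * x : ℝ) : ℂ) * l) =
        ((profile H x * x ^ n : ℝ) : ℂ) * ((pochRatio (3 / 2 - H) (2 - 2 * H) n : ℂ) *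
          (Complex.I * (t * l)) ^ n / n.factorial) := fun x => by
      rw [kernelSeries, Complex.real_smul]
      push_cast
      rw [show Complex.I * (t * x * l) = x * (Complex.I * (t * l)) by ring, mul_pow]
      ring
    rw [intervalIntegral.integral_congr fun x _ => e x, intervalIntegral.integral_mul_const,
      intervalIntegral.integral_ofReal, Complex.real_smul]
    have hm := volConst_mul_moment hH0 hH1 n
    have hp := (pochRatio_pos (x := 3 / 2 - H) (y := 2 - 2 * H) (by linarith) (by linarith) n).ne'
    rw [← pochRatio_inv (3 / 2 - H)] at hm
    have hm2 : volConst H * (∫ x in (0 : ℝ)..1, profile H x * x ^ n) *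
        pochRatio (3 / 2 - H) (2 - 2 * H) n = 1 / (n + 1) := by
      rw [hm]
      generalize pochRatio (3 / 2 - H) (2 - 2 * H) n = p at *
      field_simp
    have hm3 := congrArg (fun x : ℝ => (x : ℂ)) hm2
    push_cast at hm3
    rw [Nat.factorial_succ]
    push_cast
    generalize (∫ x in (0 : ℝ)..1, profile H x * x ^ n) = M at *
    rw [show (t : ℂ) * ↑(volConst H) * (M * (↑(pochRatio (3 / 2 - H) (2 - 2 * H) n) *
      (Complex.I * (↑t * ↑l)) ^ n / ↑n.factorial)) = t * (Complex.I * (↑t * ↑l)) ^ n / ↑n.factorial *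
      (volConst H * M * (pochRatio (3 / 2 - H) (2 - 2 * H) n)) by ring, hm3]
    have : (n : ℂ) + 1 ≠ 0 := Nat.cast_add_one_ne_zero n
    have : (n.factorial : ℂ) ≠ 0 := by exact_mod_cast n.factorial_ne_zero
    field_simp
  have hs3 := hs2.congr_terms hterm rfl
  rw [expFun]
  split_ifs with hl
  -- At `l = 0` only the term `n = 0` survives, in agreement with the value `t` prescribed there.
  · refine hs3.unique ((hasSum_ite_eq (0 : ℕ) (t : ℂ)).congr_terms (fun n => ?_) rfl)
    rcases n with _ | n <;> simp [hl]
  · exact hs3.unique (hasSum_exp_sub_one_div t (by exact_mod_cast hl))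

end FBM

end


/-! ### Spectral side: norms and inner products of the functions `e_t`. -/

noncomputable section

namespace FBM

/-- Tonelli for a nonnegative integrand with known inner integrals. Integrability of `a` and `b` is
not needed: both sides are `toReal` of the same extended integral. -/
lemma integral_integral_swap_Ioi {f : ℝ → ℝ → ℝ} {a b : ℝ → ℝ}
    (hf : Measurable (Function.uncurry f)) (h0 : ∀ x ∈ Ioi (0 : ℝ), ∀ y ∈ Ioi (0 : ℝ), 0 ≤ f x y)
    (hx : ∀ x ∈ Ioi (0 : ℝ), IntegrableOn (fun y => f x y) (Ioi 0))
    (hy : ∀ y ∈ Ioi (0 : ℝ), IntegrableOn (fun x => f x y) (Ioi 0))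
    (ha : ∀ x ∈ Ioi (0 : ℝ), ∫ y in Ioi 0, f x y = a x)
    (hb : ∀ y ∈ Ioi (0 : ℝ), ∫ x in Ioi 0, f x y = b y)
    (hma : Measurable a) (hmb : Measurable b) :
    ∫ x in Ioi 0, a x = ∫ y in Ioi 0, b y := by
  have ha0 : ∀ x ∈ Ioi (0 : ℝ), 0 ≤ a x := fun x hx' => by
    rw [← ha x hx']; exact setIntegral_nonneg measurableSet_Ioi (h0 x hx')
  have hb0 : ∀ y ∈ Ioi (0 : ℝ), 0 ≤ b y := fun y hy' => by
    rw [← hb y hy']; exact setIntegral_nonneg measurableSet_Ioi fun x hx' => h0 x hx' y hy'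
  rw [integral_eq_lintegral_of_nonneg_ae ((ae_restrict_iff' measurableSet_Ioi).2
      (Filter.Eventually.of_forall ha0)) hma.aestronglyMeasurable,
    integral_eq_lintegral_of_nonneg_ae ((ae_restrict_iff' measurableSet_Ioi).2
      (Filter.Eventually.of_forall hb0)) hmb.aestronglyMeasurable]
  congr 1
  calc ∫⁻ x in Ioi 0, ENNReal.ofReal (a x)
      = ∫⁻ x in Ioi 0, ∫⁻ y in Ioi 0, ENNReal.ofReal (f x y) := by
        refine setLIntegral_congr_fun measurableSet_Ioi fun x hx' => ?_
        rw [← ha x hx', ofReal_integral_eq_lintegral_ofReal (hx x hx')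
          ((ae_restrict_iff' measurableSet_Ioi).2 (Filter.Eventually.of_forall (h0 x hx')))]
    _ = ∫⁻ y in Ioi 0, ∫⁻ x in Ioi 0, ENNReal.ofReal (f x y) :=
        lintegral_lintegral_swap (ENNReal.measurable_ofReal.comp hf).aemeasurable
    _ = ∫⁻ y in Ioi 0, ENNReal.ofReal (b y) := by
        refine setLIntegral_congr_fun measurableSet_Ioi fun y hy' => ?_
        rw [← hb y hy', ofReal_integral_eq_lintegral_ofReal (hy y hy')
          ((ae_restrict_iff' measurableSet_Ioi).2
            (Filter.Eventually.of_forall fun x hx' => h0 x hx' y hy'))]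

variable {H : ℝ}

/-- With `1/(1+y²) = ∫ exp(-x(1+y²)) dx` the inner integral over `y` is `Γ(H)/2 · x^(-H) exp(-x)`;
integration over `x` gives `Γ(H)Γ(1-H)/2`, and the reflection formula applies. -/
lemma integral_rpow_div_one_add_sq (hH0 : 0 < H) (hH1 : H < 1) :
    ∫ y in Ioi (0 : ℝ), y ^ (2 * H - 1) / (1 + y ^ 2) = Real.pi / (2 * Real.sin (Real.pi * H)) := by
  have key := integral_integral_swap_Ioi
    (f := fun y x => y ^ (2 * H - 1) * Real.exp (-(x * (1 + y ^ 2))))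
    (a := fun y => y ^ (2 * H - 1) / (1 + y ^ 2))
    (b := fun x => 1 / 2 * Real.Gamma H * (Real.exp (-x) * x ^ ((1 - H) - 1)))
    (by unfold Function.uncurry; fun_prop)
    (fun y hy x _ => mul_nonneg (Real.rpow_nonneg (le_of_lt hy) _) (Real.exp_pos _).le)
    (fun y _ => by
      have hy : -(1 + y ^ 2) < 0 := by nlinarith [sq_nonneg y]
      refine ((integrableOn_exp_mul_Ioi hy 0).const_mul (y ^ (2 * H - 1))).congr
        (Filter.Eventually.of_forall fun x => ?_)
      simp only
      ring_nf)
    (fun x hx => by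
      have h := (integrableOn_rpow_mul_exp_neg_mul_rpow (p := 2) (s := 2 * H - 1) (b := x)
        (by linarith) (by norm_num) hx).mul_const (Real.exp (-x))
      refine h.congr (Filter.Eventually.of_forall fun y => ?_)
      simp only
      rw [mul_assoc, ← Real.exp_add, Real.rpow_two]
      ring_nf)
    (fun y _ => by
      have hy : -(1 + y ^ 2) < 0 := by nlinarith [sq_nonneg y]
      have hy' : 1 + y ^ 2 ≠ 0 := by positivity
      have h := integral_exp_mul_Ioi hy 0
      rw [integral_const_mul]
      simp only [show ∀ x : ℝ, -(x * (1 + y ^ 2)) = -(1 + y ^ 2) * x from fun x => by ring]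
      rw [h, mul_zero, Real.exp_zero]
      field_simp)
    (fun x hx => by
      have h := integral_rpow_mul_exp_neg_mul_rpow (p := 2) (q := 2 * H - 1) (b := x)
        (by norm_num) (by linarith) hx
      have e : ∀ y : ℝ, y ^ (2 * H - 1) * Real.exp (-(x * (1 + y ^ 2))) =
          y ^ (2 * H - 1) * Real.exp (-x * y ^ (2 : ℝ)) * Real.exp (-x) := fun y => by
        rw [mul_assoc, ← Real.exp_add, Real.rpow_two]
        ring_nf
      simp only [e]
      rw [integral_mul_const, h, show -(2 * H - 1 + 1) / 2 = 1 - H - 1 by ring,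
        show (2 * H - 1 + 1) / 2 = H by ring]
      ring)
    (by fun_prop) (by fun_prop)
  have hr := Real.Gamma_mul_Gamma_one_sub H
  rw [key, integral_const_mul, ← Real.Gamma_eq_integral (by linarith)]
  rw [mul_assoc, hr]
  have : Real.sin (Real.pi * H) ≠ 0 :=
    (Real.sin_pos_of_pos_of_lt_pi (by positivity) (by nlinarith [Real.pi_pos])).ne'
  field_simp

lemma hasDerivAt_laplace_one_sub_cos {y : ℝ} (hy : 0 < y) (x : ℝ) :
    HasDerivAt (fun x => -(Real.exp (-(x * y)) / y) -
        Real.exp (-(x * y)) * (Real.sin x - y * Real.cos x) / (1 + y ^ 2))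
      ((1 - Real.cos x) * Real.exp (-(x * y))) x := by
  have d1 : HasDerivAt (fun x : ℝ => Real.exp (-(x * y))) (Real.exp (-(x * y)) * (-(1 * y))) x :=
    ((hasDerivAt_id' x).mul_const y).neg.exp
  have d2 : HasDerivAt (fun x : ℝ => Real.sin x - y * Real.cos x)
      (Real.cos x - y * (-Real.sin x)) x :=
    (Real.hasDerivAt_sin x).sub ((Real.hasDerivAt_cos x).const_mul y)
  refine ((d1.div_const y).neg.sub ((d1.mul d2).div_const (1 + y ^ 2))).congr_deriv ?_
  have : 1 + y ^ 2 ≠ 0 := by positivity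
  field_simp
  ring

lemma tendsto_laplace_one_sub_cos {y : ℝ} (hy : 0 < y) :
    Filter.Tendsto (fun x => -(Real.exp (-(x * y)) / y) -
        Real.exp (-(x * y)) * (Real.sin x - y * Real.cos x) / (1 + y ^ 2)) Filter.atTop (nhds 0) := by
  have h1 : Filter.Tendsto (fun x : ℝ => Real.exp (-(x * y))) Filter.atTop (nhds 0) :=
    Real.tendsto_exp_neg_atTop_nhds_zero.comp (Filter.tendsto_id.atTop_mul_const hy)
  have h2 : Filter.Tendsto (fun x : ℝ => Real.exp (-(x * y)) * (Real.sin x - y * Real.cos x))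
      Filter.atTop (nhds 0) := by
    refine h1.zero_mul_isBoundedUnder_le ?_
    refine Filter.isBoundedUnder_of ⟨1 + y, fun x => ?_⟩
    simp only [Function.comp_apply, Real.norm_eq_abs]
    refine (abs_sub _ _).trans ?_
    rw [abs_mul, abs_of_pos hy]
    have := Real.abs_sin_le_one x
    have := Real.abs_cos_le_one x
    nlinarith
  have := (h1.div_const y).neg.sub (h2.div_const (1 + y ^ 2))
  simpa using this

/-- The power `x^(-1-2H)` is a Laplace transform of `y^(2H)` up to `Γ(1+2H)`. After the exchange, `∫
(1 - cos x) exp(-xy) dx = 1/(y(1+y²))` reduces the claim to the preceding rational integral. -/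
lemma integral_one_sub_cos (hH0 : 0 < H) (hH1 : H < 1) :
    ∫ x in Ioi (0 : ℝ), (1 - Real.cos x) * x ^ (-1 - 2 * H) =
      Real.pi / (2 * Real.sin (Real.pi * H) * Real.Gamma (1 + 2 * H)) := by
  have hG := Real.Gamma_pos_of_pos (show 0 < 1 + 2 * H by linarith)
  have key := integral_integral_swap_Ioi
    (f := fun x y => (1 - Real.cos x) * (y ^ (2 * H) * Real.exp (-(x * y))))
    (a := fun x => Real.Gamma (1 + 2 * H) * ((1 - Real.cos x) * x ^ (-1 - 2 * H)))
    (b := fun y => y ^ (2 * H - 1) / (1 + y ^ 2))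
    (by unfold Function.uncurry; fun_prop)
    (fun x _ y hy => mul_nonneg (by linarith [Real.cos_le_one x])
      (mul_nonneg (Real.rpow_nonneg (le_of_lt hy) _) (Real.exp_pos _).le))
    (fun x hx => by
      have h := (integrableOn_rpow_mul_exp_neg_mul_rpow (p := 1) (s := 2 * H) (b := x)
        (by linarith) (by norm_num) hx).const_mul (1 - Real.cos x)
      refine h.congr (Filter.Eventually.of_forall fun y => ?_)
      simp only [Real.rpow_one, neg_mul])
    (fun y hy => by
      have h := integrableOn_Ioi_deriv_of_nonneg' (a := 0)
        (fun x _ => hasDerivAt_laplace_one_sub_cos hy x)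
        (fun x _ => mul_nonneg (by linarith [Real.cos_le_one x]) (Real.exp_pos _).le)
        (tendsto_laplace_one_sub_cos hy)
      refine (h.const_mul (y ^ (2 * H))).congr (Filter.Eventually.of_forall fun x => ?_)
      simp only
      ring)
    (fun x hx => by
      have h := Real.integral_rpow_mul_exp_neg_mul_Ioi (a := 1 + 2 * H) (r := x) (by linarith) hx
      rw [show 1 + 2 * H - 1 = 2 * H by ring] at h
      rw [integral_const_mul, h, one_div, Real.inv_rpow (le_of_lt hx), ← Real.rpow_neg (le_of_lt hx),
        show -(1 + 2 * H) = -1 - 2 * H by ring]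
      ring)
    (fun y hy => by
      have hy0 : 0 < y := hy
      have h := integral_Ioi_of_hasDerivAt_of_nonneg' (a := 0)
        (fun x _ => hasDerivAt_laplace_one_sub_cos hy x)
        (fun x _ => mul_nonneg (by linarith [Real.cos_le_one x]) (Real.exp_pos _).le)
        (tendsto_laplace_one_sub_cos hy)
      have e : ∀ x : ℝ, (1 - Real.cos x) * (y ^ (2 * H) * Real.exp (-(x * y))) =
        y ^ (2 * H) * ((1 - Real.cos x) * Real.exp (-(x * y))) := fun x => by ring
      simp only [e]
      rw [integral_const_mul, h]
      have e2 : y ^ (2 * H) = y ^ (2 * H - 1) * y := by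
        rw [← Real.rpow_add_one hy0.ne']; ring_nf
      have : 1 + y ^ 2 ≠ 0 := by positivity
      rw [e2]
      simp only [zero_mul, neg_zero, Real.exp_zero, Real.sin_zero, Real.cos_zero]
      field_simp
      ring)
    (by fun_prop) (by fun_prop)
  rw [integral_rpow_div_one_add_sq hH0 hH1, integral_const_mul] at key
  rw [← div_div, ← key]
  field_simp

/-- The constant of the spectral density. -/
def specConst (H : ℝ) : ℝ := (2 * Real.pi)⁻¹ * Real.sin (Real.pi * H) * Real.Gamma (1 + 2 * H)

lemma sin_pi_mul_pos (hH0 : 0 < H) (hH1 : H < 1) : 0 < Real.sin (Real.pi * H) :=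
  Real.sin_pos_of_pos_of_lt_pi (by positivity) (by nlinarith [Real.pi_pos])

lemma specConst_pos (hH0 : 0 < H) (hH1 : H < 1) : 0 < specConst H := by
  have := sin_pi_mul_pos hH0 hH1
  have := Real.Gamma_pos_of_pos (show 0 < 1 + 2 * H by linarith)
  have := Real.pi_pos
  unfold specConst
  positivity

lemma integral_one_sub_cos_mul (hH0 : 0 < H) (hH1 : H < 1) {t : ℝ} (ht : 0 < t) :
    ∫ x in Ioi (0 : ℝ), (1 - Real.cos (t * x)) * x ^ (-1 - 2 * H) =
      t ^ (2 * H) * (Real.pi / (2 * Real.sin (Real.pi * H) * Real.Gamma (1 + 2 * H))) := by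
  have h := integral_comp_mul_left_Ioi (fun x => (1 - Real.cos x) * x ^ (-1 - 2 * H)) 0 ht
  rw [mul_zero, integral_one_sub_cos hH0 hH1] at h
  have e : ∀ x ∈ Ioi (0 : ℝ), (1 - Real.cos (t * x)) * x ^ (-1 - 2 * H) =
      t ^ (1 + 2 * H) * ((1 - Real.cos (t * x)) * (t * x) ^ (-1 - 2 * H)) := fun x hx => by
    have a1 : t ^ (1 + 2 * H) * t ^ (-1 - 2 * H) = 1 := by
      rw [← Real.rpow_add ht]; ring_nf; exact Real.rpow_zero t
    rw [Real.mul_rpow ht.le (le_of_lt hx)]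
    linear_combination -((1 - Real.cos (t * x)) * x ^ (-1 - 2 * H)) * a1
  rw [setIntegral_congr_fun measurableSet_Ioi e, integral_const_mul, h, smul_eq_mul,
    add_comm 1, Real.rpow_add_one ht.ne']
  field_simp

/-- The increment variances of fractional Brownian motion in the spectral domain. -/
lemma integral_spectral (hH0 : 0 < H) (hH1 : H < 1) (t : ℝ) :
    ∫ l : ℝ, specConst H * |l| ^ (1 - 2 * H) * (2 * (1 - Real.cos (t * l)) / l ^ 2) =
      |t| ^ (2 * H) := by
  rcases eq_or_ne t 0 with rfl | ht
  · simp [Real.zero_rpow (show 2 * H ≠ 0 by linarith)]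
  have h := integral_comp_abs
    (f := fun l => specConst H * l ^ (1 - 2 * H) * (2 * (1 - Real.cos (|t| * l)) / l ^ 2))
  have e : ∀ l : ℝ, specConst H * |l| ^ (1 - 2 * H) * (2 * (1 - Real.cos (t * l)) / l ^ 2) =
      specConst H * |l| ^ (1 - 2 * H) * (2 * (1 - Real.cos (|t| * |l|)) / |l| ^ 2) := fun l => by
    rw [sq_abs, ← abs_mul, Real.cos_abs]
  have e2 : ∀ l ∈ Ioi (0 : ℝ),
      specConst H * l ^ (1 - 2 * H) * (2 * (1 - Real.cos (|t| * l)) / l ^ 2) =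
      2 * specConst H * ((1 - Real.cos (|t| * l)) * l ^ (-1 - 2 * H)) := fun l hl => by
    have hl0 : (0 : ℝ) < l := hl
    have : l ^ (1 - 2 * H) = l ^ (-1 - 2 * H) * l ^ 2 := by
      rw [← Real.rpow_add_natCast hl0.ne']; congr 1; push_cast; ring
    rw [this]
    field_simp
  simp only [e]
  rw [h, setIntegral_congr_fun measurableSet_Ioi e2, integral_const_mul,
    integral_one_sub_cos_mul hH0 hH1 (abs_pos.2 ht), specConst]
  have h1 := (sin_pi_mul_pos hH0 hH1).ne'
  have h2 := (Real.Gamma_pos_of_pos (show 0 < 1 + 2 * H by linarith)).ne'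
  have h3 := Real.pi_pos.ne'
  field_simp

lemma integrable_spectral (hH0 : 0 < H) (hH1 : H < 1) (t : ℝ) :
    Integrable fun l : ℝ =>
      specConst H * |l| ^ (1 - 2 * H) * (2 * (1 - Real.cos (t * l)) / l ^ 2) := by
  rcases eq_or_ne t 0 with rfl | ht
  · simp
  -- The integral of a nonintegrable function is `0` by convention, so the nonzero value already
  -- computed forces integrability.
  refine Integrable.of_integral_ne_zero ?_
  rw [integral_spectral hH0 hH1]
  have := abs_pos.2 ht
  positivity

lemma measurable_specDensity (H : ℝ) :
    Measurable fun l : ℝ => ENNReal.ofReal ((2 * Real.pi)⁻¹ * Real.sin (Real.pi * H) *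
      Real.Gamma (1 + 2 * H) * |l| ^ (1 - 2 * H)) := by
  fun_prop

lemma toReal_specDensity (hH0 : 0 < H) (hH1 : H < 1) (l : ℝ) :
    (ENNReal.ofReal ((2 * Real.pi)⁻¹ * Real.sin (Real.pi * H) *
      Real.Gamma (1 + 2 * H) * |l| ^ (1 - 2 * H))).toReal = specConst H * |l| ^ (1 - 2 * H) := by
  have := specConst_pos hH0 hH1
  rw [← specConst, ENNReal.toReal_ofReal (by positivity)]

lemma integral_specMeasure {E : Type*} [NormedAddCommGroup E] [NormedSpace ℝ E]
    (hH0 : 0 < H) (hH1 : H < 1) (F : ℝ → E) :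
    ∫ l, F l ∂(specMeasure H) = ∫ l, (specConst H * |l| ^ (1 - 2 * H)) • F l := by
  rw [specMeasure, integral_withDensity_eq_integral_toReal_smul (measurable_specDensity H) (by simp)]
  simp only [toReal_specDensity hH0 hH1]

lemma integrable_specMeasure_iff {E : Type*} [NormedAddCommGroup E] [NormedSpace ℝ E]
    (hH0 : 0 < H) (hH1 : H < 1) (F : ℝ → E) :
    Integrable F (specMeasure H) ↔ Integrable fun l => (specConst H * |l| ^ (1 - 2 * H)) • F l := by
  rw [specMeasure, integrable_withDensity_iff_integrable_smul' (measurable_specDensity H) (by simp)]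
  simp only [toReal_specDensity hH0 hH1]

lemma norm_exp_sub_exp_sq (a b : ℝ) :
    ‖Complex.exp (Complex.I * a) - Complex.exp (Complex.I * b)‖ ^ 2 = 2 * (1 - Real.cos (a - b)) := by
  rw [← Complex.normSq_eq_norm_sq, mul_comm, mul_comm Complex.I, Complex.exp_mul_I, Complex.exp_mul_I,
    ← Complex.ofReal_cos, ← Complex.ofReal_sin, ← Complex.ofReal_cos, ← Complex.ofReal_sin,
    Complex.normSq_apply, Real.cos_sub]
  simp only [Complex.sub_re, Complex.add_re, Complex.mul_re, Complex.ofReal_re, Complex.ofReal_im,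
    Complex.I_re, Complex.I_im, Complex.sub_im, Complex.add_im, Complex.mul_im]
  linear_combination Real.sin_sq_add_cos_sq a + Real.sin_sq_add_cos_sq b

lemma norm_expFun_sub_sq (t s : ℝ) {l : ℝ} (hl : l ≠ 0) :
    ‖expFun t l - expFun s l‖ ^ 2 = 2 * (1 - Real.cos ((t - s) * l)) / l ^ 2 := by
  rw [expFun, expFun, if_neg hl, if_neg hl, ← sub_div, sub_sub_sub_cancel_right, norm_div, div_pow,
    norm_mul, Complex.norm_I, one_mul, Complex.norm_real, Real.norm_eq_abs, sq_abs,
    show Complex.I * l * t = Complex.I * ((l * t : ℝ) : ℂ) by push_cast; ring,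
    show Complex.I * l * s = Complex.I * ((l * s : ℝ) : ℂ) by push_cast; ring,
    norm_exp_sub_exp_sq, show l * t - l * s = (t - s) * l by ring]

lemma expFun_zero (l : ℝ) : expFun 0 l = 0 := by
  simp [expFun]

lemma measurable_expFun (t : ℝ) : Measurable (expFun t) := by
  unfold expFun
  exact Measurable.ite (measurableSet_singleton 0) measurable_const (by fun_prop)

lemma ae_eq_spectral (t s : ℝ) :
    (fun l : ℝ => (specConst H * |l| ^ (1 - 2 * H)) • ‖expFun t l - expFun s l‖ ^ 2) =ᵐ[volume]
      fun l : ℝ => specConst H * |l| ^ (1 - 2 * H) * (2 * (1 - Real.cos ((t - s) * l)) / l ^ 2) := by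
  have h : ∀ᵐ l : ℝ, l ≠ 0 := by simp [ae_iff]
  filter_upwards [h] with l hl
  rw [norm_expFun_sub_sq t s hl, smul_eq_mul]

lemma integrable_norm_expFun_sub_sq (hH0 : 0 < H) (hH1 : H < 1) (t s : ℝ) :
    Integrable (fun l => ‖expFun t l - expFun s l‖ ^ 2) (specMeasure H) := by
  rw [integrable_specMeasure_iff hH0 hH1]
  exact (integrable_spectral hH0 hH1 (t - s)).congr (ae_eq_spectral t s).symm

lemma integral_norm_expFun_sub_sq (hH0 : 0 < H) (hH1 : H < 1) (t s : ℝ) :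
    ∫ l, ‖expFun t l - expFun s l‖ ^ 2 ∂(specMeasure H) = |t - s| ^ (2 * H) := by
  rw [integral_specMeasure hH0 hH1, integral_congr_ae (ae_eq_spectral t s),
    integral_spectral hH0 hH1]

lemma memLp_expFun (hH0 : 0 < H) (hH1 : H < 1) (t : ℝ) : MemLp (expFun t) 2 (specMeasure H) := by
  rw [memLp_two_iff_integrable_sq_norm (measurable_expFun t).aestronglyMeasurable]
  simpa [expFun_zero] using integrable_norm_expFun_sub_sq hH0 hH1 t 0

lemma expFun_neg (t l : ℝ) : expFun t (-l) = (starRingEnd ℂ) (expFun t l) := by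
  rw [expFun, expFun]
  by_cases hl : l = 0
  · simp [hl]
  · rw [if_neg (by simpa using hl), if_neg hl]
    simp only [map_div₀, map_sub, map_one, map_mul, ← Complex.exp_conj, Complex.conj_I,
      Complex.conj_ofReal]
    push_cast
    ring_nf

lemma integral_add_sub_div_two {μ : Measure ℝ} {f g h : ℝ → ℝ} (hf : Integrable f μ)
    (hg : Integrable g μ) (hh : Integrable h μ) :
    ∫ x, (f x + g x - h x) / 2 ∂μ = (∫ x, f x ∂μ + ∫ x, g x ∂μ - ∫ x, h x ∂μ) / 2 := by
  have hfg : Integrable (fun x => f x + g x) μ := hf.add hg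
  rw [integral_div, integral_sub hfg hh, integral_add hf hg]

/-- The covariance of fractional Brownian motion in the spectral domain. -/
lemma integral_expFun_mul_conj (hH0 : 0 < H) (hH1 : H < 1) (t s : ℝ) :
    ∫ l, expFun t l * (starRingEnd ℂ) (expFun s l) ∂(specMeasure H) =
      (((|t| ^ (2 * H) + |s| ^ (2 * H) - |t - s| ^ (2 * H)) / 2 : ℝ) : ℂ) := by
  set F : ℝ → ℂ := fun l => expFun t l * (starRingEnd ℂ) (expFun s l) with hF
  have hi : Integrable F (specMeasure H) :=
    (memLp_expFun hH0 hH1 t).integrable_mul (memLp_expFun hH0 hH1 s).star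
  -- The spectral density is even and `e_t(-l)` is the conjugate of `e_t(l)`, so the inner product
  -- is real.
  have hneg : ∫ l, F l ∂(specMeasure H) = ∫ l, (starRingEnd ℂ) (F l) ∂(specMeasure H) := by
    rw [integral_specMeasure hH0 hH1, integral_specMeasure hH0 hH1,
      ← integral_neg_eq_self]
    refine integral_congr_ae (Filter.Eventually.of_forall fun l => ?_)
    simp only [hF, expFun_neg, abs_neg, map_mul]
  have him : (∫ l, F l ∂(specMeasure H)).im = 0 := by
    rw [integral_conj] at hneg
    exact Complex.conj_eq_iff_im.1 hneg.symm
  have hre : (∫ l, F l ∂(specMeasure H)).re =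
      (|t| ^ (2 * H) + |s| ^ (2 * H) - |t - s| ^ (2 * H)) / 2 := by
    have h1 := integral_re hi
    simp only [RCLike.re_to_complex] at h1
    -- Polarisation; `e_0 = 0` puts all three terms in the form of increments.
    have h2 : ∀ l, (F l).re = (‖expFun t l - expFun 0 l‖ ^ 2 + ‖expFun s l - expFun 0 l‖ ^ 2 -
        ‖expFun t l - expFun s l‖ ^ 2) / 2 := fun l => by
      rw [expFun_zero, sub_zero, sub_zero, ← Complex.normSq_eq_norm_sq, ← Complex.normSq_eq_norm_sq,
        ← Complex.normSq_eq_norm_sq, Complex.normSq_sub]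
      ring
    have i1 := integrable_norm_expFun_sub_sq hH0 hH1 t 0
    have i2 := integrable_norm_expFun_sub_sq hH0 hH1 s 0
    have i3 := integrable_norm_expFun_sub_sq hH0 hH1 t s
    rw [← h1]
    simp only [h2]
    rw [integral_add_sub_div_two i1 i2 i3,
      integral_norm_expFun_sub_sq hH0 hH1, integral_norm_expFun_sub_sq hH0 hH1,
      integral_norm_expFun_sub_sq hH0 hH1, sub_zero, sub_zero]
  apply Complex.ext
  · rw [hre, Complex.ofReal_re]
  · rw [him, Complex.ofReal_im]

end FBM

end


/-! ### The isometry of the closed spans and its integral formula. -/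

noncomputable section

namespace FBM

section Gram

variable {ι E F : Type*} [NormedAddCommGroup E] [InnerProductSpace ℂ E]
  [NormedAddCommGroup F] [InnerProductSpace ℂ F]

lemma norm_linearCombination_eq_of_gram {x : ι → E} {y : ι → F}
    (h : ∀ i j, inner ℂ (y i) (y j) = inner ℂ (x i) (x j)) (c : ι →₀ ℂ) :
    ‖Finsupp.linearCombination ℂ y c‖ = ‖Finsupp.linearCombination ℂ x c‖ := by
  have key : inner ℂ (Finsupp.linearCombination ℂ y c) (Finsupp.linearCombination ℂ y c)
      = inner ℂ (Finsupp.linearCombination ℂ x c) (Finsupp.linearCombination ℂ x c) := by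
    simp only [Finsupp.linearCombination_apply, Finsupp.sum_inner, Finsupp.inner_sum,
      inner_smul_left, inner_smul_right, h]
  rw [@norm_eq_sqrt_re_inner ℂ, @norm_eq_sqrt_re_inner ℂ, key]

/-- The linear combinations of a family, as elements of the closure of its span. -/
def closureCombination (x : ι → E) :
    (ι →₀ ℂ) →ₗ[ℂ] (Submodule.span ℂ (range x)).topologicalClosure :=
  (Finsupp.linearCombination ℂ x).codRestrict _ fun c =>
    Submodule.le_topologicalClosure _ (by
      rw [← Finsupp.range_linearCombination]
      exact LinearMap.mem_range_self _ c)

lemma denseRange_closureCombination (x : ι → E) : DenseRange (closureCombination x) := by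
  intro v
  rw [closure_subtype]
  have hv := v.2
  rw [← SetLike.mem_coe, Submodule.topologicalClosure_coe] at hv
  refine closure_mono ?_ hv
  intro w hw
  rw [SetLike.mem_coe, ← Finsupp.range_linearCombination] at hw
  obtain ⟨c, rfl⟩ := hw
  exact ⟨closureCombination x c, mem_range_self c, rfl⟩

/-- Two families with the same Gram matrix have isometric closed spans. -/
lemma exists_linearIsometryEquiv_of_gram [CompleteSpace E] [CompleteSpace F]
    {x : ι → E} {y : ι → F} (h : ∀ i j, inner ℂ (y i) (y j) = inner ℂ (x i) (x j)) :
    ∃ U : (Submodule.span ℂ (range x)).topologicalClosure ≃ₗᵢ[ℂ]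
        (Submodule.span ℂ (range y)).topologicalClosure,
      ∀ i, ∃ k : (Submodule.span ℂ (range x)).topologicalClosure, (k : E) = x i ∧ (U k : F) = y i := by
  have : CompleteSpace (Submodule.span ℂ (range x)).topologicalClosure :=
    (Submodule.isClosed_topologicalClosure _).completeSpace_coe
  have : CompleteSpace (Submodule.span ℂ (range y)).topologicalClosure :=
    (Submodule.isClosed_topologicalClosure _).completeSpace_coe
  -- The comparison takes place on formal combinations, so no linear independence is needed: a
  -- combination that vanishes on one side has norm zero on the other.
  have hnorm : ∀ c, ‖closureCombination y (LinearEquiv.refl ℂ (ι →₀ ℂ) c)‖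
      = ‖closureCombination x c‖ := norm_linearCombination_eq_of_gram h
  refine ⟨(LinearEquiv.refl ℂ (ι →₀ ℂ)).extendOfIsometry (closureCombination x)
    (closureCombination y) (denseRange_closureCombination x) (denseRange_closureCombination y)
    hnorm, fun i => ⟨closureCombination x (Finsupp.single i 1),
      ?_, ?_⟩⟩
  · simp [closureCombination]
  · rw [LinearEquiv.extendOfIsometry_eq]
    simp [closureCombination]

end Gram

variable {H T : ℝ}

lemma setOf_ae_eq_eq_range {α : Type*} [MeasurableSpace α] {μ : Measure α} {f : ℝ → α → ℂ}
    (hf : ∀ t ∈ Icc 0 T, MemLp (f t) 2 μ) :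
    {g : Lp ℂ 2 μ | ∃ t ∈ Icc 0 T, g =ᵐ[μ] f t}
      = range fun t : Icc 0 T => (hf t t.2).toLp (f t) := by
  ext g
  constructor
  · rintro ⟨t, ht, h⟩
    exact ⟨⟨t, ht⟩, Lp.ext ((hf t ht).coeFn_toLp.trans h.symm)⟩
  · rintro ⟨t, rfl⟩
    exact ⟨t, t.2, (hf t t.2).coeFn_toLp⟩

lemma inner_toLp {α : Type*} [MeasurableSpace α] {μ : Measure α} {f g : α → ℂ}
    (hf : MemLp f 2 μ) (hg : MemLp g 2 μ) :
    inner ℂ (hf.toLp f) (hg.toLp g) = ∫ a, g a * (starRingEnd ℂ) (f a) ∂μ := by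
  rw [L2.inner_def]
  refine integral_congr_ae ?_
  filter_upwards [hf.coeFn_toLp, hg.coeFn_toLp] with a h1 h2
  rw [h1, h2]
  rfl

lemma conj_movAvgKernel (hH0 : 0 < H) (hH1 : H < 1) (t u : ℝ) :
    (starRingEnd ℂ) (movAvgKernel H t u) = movAvgKernel H t u := by
  by_cases h : u ∈ Ioo 0 t
  · rw [movAvgKernel_eq hH0 hH1 h.1 h.2, Complex.conj_ofReal]
  · rw [movAvgKernel_eq_zero h, map_zero]

lemma integral_movAvgKernel_mul_conj (hH0 : 0 < H) (hH1 : H < 1) {t s : ℝ}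
    (ht : t ∈ Icc 0 T) (hs : s ∈ Icc 0 T) :
    ∫ u, movAvgKernel H t u * (starRingEnd ℂ) (movAvgKernel H s u) ∂varMeasure H T
      = (((|t| ^ (2 * H) + |s| ^ (2 * H) - |t - s| ^ (2 * H)) / 2 : ℝ) : ℂ) := by
  simp only [conj_movAvgKernel hH0 hH1, abs_of_nonneg ht.1, abs_of_nonneg hs.1]
  rcases le_total t s with h | h
  · rw [integral_movAvgKernel_mul_movAvgKernel hH0 hH1 ht.1 h hs.2, abs_sub_comm,
      abs_of_nonneg (sub_nonneg.2 h), add_comm (t ^ (2 * H))]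
  · simp only [mul_comm (movAvgKernel H t _)]
    rw [integral_movAvgKernel_mul_movAvgKernel hH0 hH1 hs.1 h ht.2,
      abs_of_nonneg (sub_nonneg.2 h)]

lemma exists_isometry (hH0 : 0 < H) (hH1 : H < 1) (T : ℝ) :
    ∃ U : kernelSpace H T ≃ₗᵢ[ℂ] specSpace H T, ∀ t ∈ Icc 0 T, ∃ k : kernelSpace H T,
        (k : Lp ℂ 2 (varMeasure H T)) =ᵐ[varMeasure H T] movAvgKernel H t ∧
        (U k : Lp ℂ 2 (specMeasure H)) =ᵐ[specMeasure H] expFun t := by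
  have hx : ∀ t ∈ Icc 0 T, MemLp (movAvgKernel H t) 2 (varMeasure H T) :=
    fun t ht => memLp_movAvgKernel hH0 hH1 ht.1
  have hy : ∀ t ∈ Icc 0 T, MemLp (expFun t) 2 (specMeasure H) :=
    fun t _ => memLp_expFun hH0 hH1 t
  rw [kernelSpace, specSpace, setOf_ae_eq_eq_range hx, setOf_ae_eq_eq_range hy]
  obtain ⟨U, hU⟩ := exists_linearIsometryEquiv_of_gram
    (x := fun t : Icc 0 T => (hx t t.2).toLp (movAvgKernel H t))
    (y := fun t : Icc 0 T => (hy t t.2).toLp (expFun t)) (fun i j => by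
      rw [inner_toLp, inner_toLp, integral_expFun_mul_conj hH0 hH1,
        integral_movAvgKernel_mul_conj hH0 hH1 j.2 i.2])
  refine ⟨U, fun t ht => ?_⟩
  obtain ⟨k, hk, hUk⟩ := hU ⟨t, ht⟩
  refine ⟨k, ?_, ?_⟩
  · rw [hk]
    exact (hx t ht).coeFn_toLp
  · rw [hUk]
    exact (hy t ht).coeFn_toLp

lemma isFiniteMeasure_varMeasure (hH1 : H < 1) (T : ℝ) : IsFiniteMeasure (varMeasure H T) := by
  refine isFiniteMeasure_withDensity_ofReal ?_
  refine Integrable.hasFiniteIntegral (Integrable.const_mul ?_ _)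
  rcases le_total 0 T with hT | hT
  · have := intervalIntegral.intervalIntegrable_rpow' (a := 0) (b := T) (r := 1 - 2 * H)
      (by linarith)
    rw [intervalIntegrable_iff_integrableOn_Icc_of_le hT] at this
    exact this
  · have h0 : volume (Icc 0 T) = 0 := by
      rw [Real.volume_Icc, ENNReal.ofReal_eq_zero]
      linarith
    rw [Measure.restrict_eq_zero.2 h0]
    exact integrable_zero_measure

lemma ae_mem_Icc_varMeasure (H T : ℝ) : ∀ᵐ u ∂varMeasure H T, u ∈ Icc 0 T :=
  (withDensity_absolutelyContinuous _ _).ae_le (ae_restrict_mem measurableSet_Icc)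

lemma exists_norm_le_on_scaled {g : ℂ → ℂ} (hg : Continuous g) (T R : ℝ) :
    ∃ C, ∀ u ∈ Icc 0 T, ∀ z : ℂ, ‖z‖ ≤ R → ‖g (u * z)‖ ≤ C := by
  obtain ⟨C, hC⟩ := (isCompact_closedBall (0 : ℂ) (T * R)).exists_bound_of_continuousOn
    hg.continuousOn
  refine ⟨C, fun u hu z hz => hC _ ?_⟩
  rw [mem_closedBall_zero_iff, norm_mul, Complex.norm_real, Real.norm_of_nonneg hu.1]
  exact mul_le_mul hu.2 hz (norm_nonneg _) (hu.1.trans hu.2)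

lemma memLp_comp_scaled (hH1 : H < 1) {g : ℂ → ℂ} (hg : Continuous g) (T : ℝ) (z : ℂ) :
    MemLp (fun u : ℝ => g (u * z)) 2 (varMeasure H T) := by
  have := isFiniteMeasure_varMeasure hH1 T
  obtain ⟨C, hC⟩ := exists_norm_le_on_scaled hg T ‖z‖
  refine MemLp.of_bound (Continuous.aestronglyMeasurable (by fun_prop)) C ?_
  filter_upwards [ae_mem_Icc_varMeasure H T] with u hu
  exact hC u hu z le_rfl

lemma integrable_mul_fourierKernel (hH1 : H < 1) {f : ℝ → ℂ} (hf : MemLp f 2 (varMeasure H T))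
    (z : ℂ) : Integrable (fun u : ℝ => f u * fourierKernel H (u * z)) (varMeasure H T) :=
  hf.integrable_mul (memLp_comp_scaled hH1 (differentiable_fourierKernel hH1).continuous T z)

/-- Differentiation under the integral sign. On the unit ball about `z₀` and for `u ∈ [0,T]`, the
derivative of the integrand is at most `‖f u‖ * (C * T)`, with `C` a bound of `φ'` on a compact
disc; `f` is integrable because `V` is finite. -/
lemma differentiable_kernelTransform (hH1 : H < 1) {f : ℝ → ℂ}
    (hf : MemLp f 2 (varMeasure H T)) : Differentiable ℂ (kernelTransform H T f) := by
  intro z₀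
  have := isFiniteMeasure_varMeasure hH1 T
  have hφ := differentiable_fourierKernel hH1
  have hφ' : Continuous (deriv (fourierKernel H)) :=
    (hφ.contDiff (n := 1)).continuous_deriv le_rfl
  obtain ⟨C, hC⟩ := exists_norm_le_on_scaled hφ' T (‖z₀‖ + 1)
  have hint : Integrable f (varMeasure H T) := hf.integrable (by norm_num)
  have key := hasDerivAt_integral_of_dominated_loc_of_deriv_le
    (μ := varMeasure H T) (F := fun (z : ℂ) (u : ℝ) => f u * fourierKernel H (u * z))
    (F' := fun (z : ℂ) (u : ℝ) => f u * (deriv (fourierKernel H) (u * z) * u))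
    (x₀ := z₀) (bound := fun u => ‖f u‖ * (C * T)) (Metric.ball_mem_nhds z₀ one_pos)
    (Filter.Eventually.of_forall fun z => (integrable_mul_fourierKernel hH1 hf z).1)
    (integrable_mul_fourierKernel hH1 hf z₀)
    (hint.1.mul (Continuous.aestronglyMeasurable (by fun_prop))) ?_ (hint.norm.mul_const _) ?_
  · exact key.2.differentiableAt
  · filter_upwards [ae_mem_Icc_varMeasure H T] with u hu z hz
    have hz' : ‖z‖ ≤ ‖z₀‖ + 1 := by
      have h1 := norm_le_norm_add_norm_sub' z z₀
      rw [mem_ball_iff_norm] at hz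
      linarith
    have h2 := hC u hu z hz'
    rw [norm_mul, norm_mul, Complex.norm_real, Real.norm_of_nonneg hu.1]
    exact mul_le_mul_of_nonneg_left
      (mul_le_mul h2 hu.2 hu.1 ((norm_nonneg _).trans h2)) (norm_nonneg _)
  · refine Filter.Eventually.of_forall fun u z _ => HasDerivAt.const_mul _ ?_
    have h1 : HasDerivAt (fun z : ℂ => (u : ℂ) * z) u z := by
      simpa using (hasDerivAt_id z).const_mul (u : ℂ)
    exact (hφ _).hasDerivAt.comp z h1

/-- `f ↦ ∫_0^T f(u) φ(uz) dV_u` as a continuous functional on `L²(V)`. -/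
lemma exists_clm_kernelTransform (hH1 : H < 1) (T : ℝ) (z : ℂ) :
    ∃ L : Lp ℂ 2 (varMeasure H T) →L[ℂ] ℂ, ∀ f, L f = kernelTransform H T f z := by
  -- The inner product is conjugate-linear in its first argument, so the representing vector is the
  -- conjugate of `φ(· z)`.
  have hφ : Continuous fun w => (starRingEnd ℂ) (fourierKernel H w) :=
    Complex.continuous_conj.comp (differentiable_fourierKernel hH1).continuous
  have hg := memLp_comp_scaled hH1 hφ T z
  refine ⟨innerSL ℂ (hg.toLp _), fun f => ?_⟩
  rw [innerSL_apply_apply, L2.inner_def, kernelTransform]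
  refine integral_congr_ae ?_
  filter_upwards [hg.coeFn_toLp] with u hu
  rw [hu]
  change f u * (starRingEnd ℂ) ((starRingEnd ℂ) _) = _
  rw [Complex.conj_conj]

/-- Along a convergent sequence in `X`, a subsequence of the images under `A` converges almost
everywhere, while each `L a` converges pointwise by continuity; the two limits agree. -/
lemma isClosed_setOf_ae_eq_clm {X α : Type*} [NormedAddCommGroup X] [NormedSpace ℂ X]
    [MeasurableSpace α] {μ : Measure α} (A : X →L[ℂ] Lp ℂ 2 μ) (L : α → X →L[ℂ] ℂ) :
    IsClosed {k : X | A k =ᵐ[μ] fun a => L a k} := by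
  refine IsSeqClosed.isClosed fun k k₀ hk hlim => ?_
  have h1 : Filter.Tendsto (fun n => A (k n)) Filter.atTop (nhds (A k₀)) :=
    (A.continuous.tendsto k₀).comp hlim
  obtain ⟨ns, hns, hae⟩ := (tendstoInMeasure_of_tendsto_Lp h1).exists_seq_tendsto_ae
  have h2 : ∀ᵐ a ∂μ, ∀ n, A (k n) a = L a (k n) := ae_all_iff.2 hk
  filter_upwards [hae, h2] with a ha hka
  refine tendsto_nhds_unique ha ?_
  simp only [hka]
  exact ((L a).continuous.tendsto k₀).comp (hlim.comp hns.tendsto_atTop)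

lemma kernelTransform_congr_ae {f g : ℝ → ℂ} (h : f =ᵐ[varMeasure H T] g) (z : ℂ) :
    kernelTransform H T f z = kernelTransform H T g z :=
  integral_congr_ae (h.mono fun u hu => by simp only [hu])

/-- An isometry with `x_t ↦ e_t` is given by integration against the Fourier kernel. -/
lemma isometry_ae_eq_kernelTransform (hH0 : 0 < H) (hH1 : H < 1)
    (U : kernelSpace H T ≃ₗᵢ[ℂ] specSpace H T)
    (hU : ∀ t ∈ Icc 0 T, ∃ k : kernelSpace H T,
        (k : Lp ℂ 2 (varMeasure H T)) =ᵐ[varMeasure H T] movAvgKernel H t ∧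
        (U k : Lp ℂ 2 (specMeasure H)) =ᵐ[specMeasure H] expFun t) (k : kernelSpace H T) :
    (U k : Lp ℂ 2 (specMeasure H)) =ᵐ[specMeasure H]
      fun l : ℝ => kernelTransform H T (k : Lp ℂ 2 (varMeasure H T)) (l : ℂ) := by
  choose L hL using exists_clm_kernelTransform hH1 T
  have hclosed := isClosed_setOf_ae_eq_clm (μ := specMeasure H)
    ((specSpace H T).subtypeL.comp (U.toContinuousLinearEquiv : kernelSpace H T →L[ℂ] _))
    (fun l : ℝ => (L l).comp (kernelSpace H T).subtypeL)
  have hspan : ∀ v (hv : v ∈ Submodule.span ℂ {f : Lp ℂ 2 (varMeasure H T) |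
      ∃ t ∈ Icc 0 T, f =ᵐ[varMeasure H T] movAvgKernel H t}),
      (U ⟨v, Submodule.le_topologicalClosure _ hv⟩ : Lp ℂ 2 (specMeasure H))
        =ᵐ[specMeasure H] fun l : ℝ => L l v := by
    intro v hv
    induction hv using Submodule.span_induction with
    | mem v hv =>
      obtain ⟨t, ht, hvt⟩ := hv
      obtain ⟨k, hk, hUk⟩ := hU t ht
      have hkv : k = ⟨v, Submodule.le_topologicalClosure _ (Submodule.subset_span ⟨t, ht, hvt⟩)⟩ :=
        Subtype.ext (Lp.ext (hk.trans hvt.symm))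
      rw [← hkv]
      filter_upwards [hUk] with l hl
      rw [hl, hL, kernelTransform_congr_ae hvt, kernelTransform_movAvgKernel hH0 hH1 ht.1 ht.2]
    | zero =>
      have h0 : (⟨0, Submodule.le_topologicalClosure _ (Submodule.zero_mem _)⟩ :
        kernelSpace H T) = 0 := rfl
      rw [h0, map_zero]
      simp only [map_zero]
      exact Lp.coeFn_zero _ _ _
    | add v w hv hw ihv ihw =>
      have h0 : (⟨v + w, Submodule.le_topologicalClosure _ (Submodule.add_mem _ hv hw)⟩ :
        kernelSpace H T) = ⟨v, Submodule.le_topologicalClosure _ hv⟩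
          + ⟨w, Submodule.le_topologicalClosure _ hw⟩ := rfl
      rw [h0, map_add, Submodule.coe_add]
      filter_upwards [ihv, ihw, Lp.coeFn_add
        (U ⟨v, Submodule.le_topologicalClosure _ hv⟩ : Lp ℂ 2 (specMeasure H))
        (U ⟨w, Submodule.le_topologicalClosure _ hw⟩ : Lp ℂ 2 (specMeasure H))] with l h1 h2 h3
      rw [h3, Pi.add_apply, h1, h2, map_add]
    | smul a v hv ihv =>
      have h0 : (⟨a • v, Submodule.le_topologicalClosure _ (Submodule.smul_mem _ a hv)⟩ :
        kernelSpace H T) = a • ⟨v, Submodule.le_topologicalClosure _ hv⟩ := rfl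
      rw [h0, map_smul, Submodule.coe_smul]
      filter_upwards [ihv, Lp.coeFn_smul a
        (U ⟨v, Submodule.le_topologicalClosure _ hv⟩ : Lp ℂ 2 (specMeasure H))] with l h1 h2
      rw [h2, Pi.smul_apply, h1, map_smul]
  -- The span is dense in `𝓚_T` also for the subspace topology, so the closed condition verified on
  -- it holds for every `k`.
  have hmem : k ∈ closure {k : kernelSpace H T | (k : Lp ℂ 2 (varMeasure H T)) ∈
      Submodule.span ℂ {f : Lp ℂ 2 (varMeasure H T) |
        ∃ t ∈ Icc 0 T, f =ᵐ[varMeasure H T] movAvgKernel H t}} := by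
    rw [closure_subtype]
    have hk : (k : Lp ℂ 2 (varMeasure H T)) ∈ closure (Submodule.span ℂ
        {f : Lp ℂ 2 (varMeasure H T) |
          ∃ t ∈ Icc 0 T, f =ᵐ[varMeasure H T] movAvgKernel H t} : Set _) := k.2
    refine closure_mono ?_ hk
    intro v hv
    exact ⟨⟨v, Submodule.le_topologicalClosure _ hv⟩, hv, rfl⟩
  have hk := closure_minimal (fun (k : kernelSpace H T) hk => hspan k hk) hclosed hmem
  simp only [← hL]
  exact hk

end FBM

end


theorem corollary3p3 (H T : ℝ) (hH0 : 0 < H) (hH1 : H < 1) (hT : 0 ≤ T) :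
    ∃ U : FBM.kernelSpace H T ≃ₗᵢ[ℂ] FBM.specSpace H T,
      -- `U` is the isometry determined by `x_t ↦ e_t`
      (∀ t ∈ Set.Icc 0 T, ∃ k : FBM.kernelSpace H T,
        (k : Lp ℂ 2 (FBM.varMeasure H T)) =ᵐ[FBM.varMeasure H T] FBM.movAvgKernel H t ∧
        (U k : Lp ℂ 2 (FBM.specMeasure H)) =ᵐ[FBM.specMeasure H] FBM.expFun t) ∧
      ∀ ψ : FBM.specSpace H T,
        (∀ z : ℂ, Integrable
          (fun u : ℝ => (U.symm ψ : Lp ℂ 2 (FBM.varMeasure H T)) u * FBM.fourierKernel H (u * z))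
          (FBM.varMeasure H T)) ∧
        Differentiable ℂ
          (FBM.kernelTransform H T (U.symm ψ : Lp ℂ 2 (FBM.varMeasure H T))) ∧
        (ψ : Lp ℂ 2 (FBM.specMeasure H)) =ᵐ[FBM.specMeasure H]
          fun l : ℝ =>
            FBM.kernelTransform H T (U.symm ψ : Lp ℂ 2 (FBM.varMeasure H T)) (l : ℂ) := by
  obtain ⟨U, hU⟩ := FBM.exists_isometry hH0 hH1 T
  refine ⟨U, hU, fun ψ => ⟨fun z => ?_, ?_, ?_⟩⟩
  · exact FBM.integrable_mul_fourierKernel hH1 (Lp.memLp _) z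
  · exact FBM.differentiable_kernelTransform hH1 (Lp.memLp _)
  · simpa only [U.apply_symm_apply]
      using FBM.isometry_ae_eq_kernelTransform hH0 hH1 U hU (U.symm ψ)
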